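/- For $N\in\{2,\infty\}$ let $\mathcal O_N$ be the Cuntz algebra, with canonical generators $t_1,t_2$ for $N=2$ and $s_1,s_2,\dots$ for $N=\infty$. For a finite word $J=(j_1,\dots,j_k)$, $k\ge 1$, in the index set of the generators $g_j$ of $\mathcal O_N$, let $P_N(J)$ be the class of representations of $\mathcal O_N$ on a complex Hilbert space $\mathcal H$ with a cyclic unit vector $\Omega$ (the GP vector) such that $g_{j_1}\cdots g_{j_k}\Omega=\Omega$ and the vectors $g_{j_l}\cdots g_{j_k}\Omega$, $1\le l\le k$, are orthonormal. Powers of letters in a word denote repetition. Let $\mathcal B$ be the $*$-algebra generated by $b_n$, $n\ge 1$, with $b_nb_m^*-b_m^*b_n=\delta_{nm}I$ and $b_nb_m-b_mb_n=b_n^*b_m^*-b_m^*b_n^*=0$. A representation of $\mathcal B$ consists of a complex Hilbert space, a dense subspace $\mathcal D$ and operators $b_n,b_n^*:\mathcal D\to\mathcal D$ that satisfy these relations and $\langle b_n^*x,y\rangle=\langle x,b_ny\rangle$ for $x,y\in\mathcal D$; a vector $\Omega\in\mathcal D$ is cyclic if $\mathcal B\Omega=\mathcal D$. Two representations are unitarily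 equivalent if some unitary maps one domain onto the other and intertwines the actions. For $1\le i\le q$ and $\lambda\ge 1$, $BF_{q,i}(\lambda)$ is the class of representations of $\mathcal B$ with a nonzero cyclic vector $\Omega$ such that, for all $n\ge 1$, $$b_{q(n-1)+i}\,b_{q(n-1)+i}^*\Omega=\lambda\Omega,\qquad b_{q(n-1)+j}\Omega=0\quad(1\le j\le q,\ j\ne i).$$ The class $BF_{p,1}(2)\oplus\cdots\oplus BF_{p,p}(2)$ consists of the representations that are unitarily equivalent to a direct sum of one member of each $BF_{p,i}(2)$, $1\le i\le p$ (on the direct sum of their domains, inside the direct sum of their Hilbert spaces). For a member of $P_\infty(J)$ with GP vector $\Omega$, its restriction to $\mathcal B$ by the recursive boson system is the representation of $\mathcal B$ on the linear span $\mathcal D$ of all $s_I\Omega$ ($I$ a finite word) that is given, pointwise on $\mathcal D$, by $$b_1=\sum_{m\ge1}\sqrt m\,s_ms_{m+1}^*,\qquad b_{n+1}=\sum_{m\ge1}s_mb_ns_m^*\quad(n\ge1).$$ For a member of $P_2(J)$ with GP vector $\Omega$, the restriction is given by the same formulas with $s_m=t_2^{m-1}t_1$, on the linear span of all $t_I\Omega$.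 Write $P_N(J)|_{\mathcal B}=C$ if $P_N(J)$ is not empty and, for each of its members and each choice of the GP vector, the restriction to $\mathcal B$ is well defined and $C$ is exactly the class of all representations of $\mathcal B$ that are unitarily equivalent to this restriction. Then for every integer $p\ge1$: 1. $P_2(12^{p-1})|_{\mathcal B}=BF_{1,1}(p)$; 2. $P_\infty(1^{p-1}2)|_{\mathcal B}=BF_{p,1}(2)\oplus\cdots\oplus BF_{p,p}(2)$; 3. $P_2(1^{p}2)|_{\mathcal B}=BF_{p,1}(2)\oplus\cdots\oplus BF_{p,p}(2)$. -/

import Mathlib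

open scoped InnerProductSpace

universe u v

/-! ### Representations of Cuntz algebras

A representation of the universal C*-algebra generated by isometries subject to the Cuntz
relations is the same thing as a family of operators satisfying these relations.
Generators are indexed from `0`: `t 0, t 1` stand for `t₁, t₂`, and `s m` stands for `s_{m+1}`. -/

section Cuntz

variable {H : Type u} [NormedAddCommGroup H] [InnerProductSpace ℂ H] [CompleteSpace H]

/-- `t 0, t 1` are the images of the canonical generators of `𝓞₂` under a representation on `H`. -/
structure IsCuntzTwo (t : Fin 2 → (H →L[ℂ] H)) : Prop where
  star_mul : ∀ i j, star (t i) * t j = if i = j then 1 else 0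
  sum_eq : t 0 * star (t 0) + t 1 * star (t 1) = 1

/-- `s 0, s 1, …` are the images of the canonical generators of `𝓞_∞` under a representation
on `H`. -/
structure IsCuntzInfty (s : ℕ → (H →L[ℂ] H)) : Prop where
  star_mul : ∀ i j, star (s i) * s j = if i = j then 1 else 0
  sum_le : ∀ k : ℕ, ∑ m ∈ Finset.range k, s m * star (s m) ≤ 1

/-- The operator `s_J = s_{j₁} ⋯ s_{j_k}` of a word `J = (j₁, …, j_k)`. -/
def wordOp {ι : Type*} (s : ι → (H →L[ℂ] H)) (J : List ι) : H →L[ℂ] H :=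
  (J.map s).prod

/-- `Ω` is a GP vector of type `P(J)` for the representation given by `s`: it is a cyclic unit
vector, `s_J Ω = Ω`, and the vectors `s_{j_l} ⋯ s_{j_k} Ω`, `1 ≤ l ≤ k`, are orthonormal. -/
structure IsGPVector {ι : Type*} (s : ι → (H →L[ℂ] H)) (J : List ι) (Ω : H) : Prop where
  norm_eq : ‖Ω‖ = 1
  cyclic : Dense {v : H | ∃ x ∈ StarAlgebra.adjoin ℂ (Set.range s), x Ω = v}
  fixed : wordOp s J Ω = Ω
  orthonormal : Orthonormal ℂ (fun l : Fin J.length => wordOp s (J.drop l) Ω)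

/-- The linear span of all `s_I Ω`, `I` a finite word. -/
def orbitSpan {ι : Type*} (s : ι → (H →L[ℂ] H)) (Ω : H) : Submodule ℂ H :=
  Submodule.span ℂ (Set.range fun I : List ι => wordOp s I Ω)

/-- The embedding `s_m = t₂^{m-1} t₁` of `𝓞_∞` into `𝓞₂`. -/
def cuntzEmbedding (t : Fin 2 → (H →L[ℂ] H)) (m : ℕ) : H →L[ℂ] H :=
  t 1 ^ m * t 0

end Cuntz

/-! ### Representations of the algebra of bosons -/

/-- A *-representation on (a dense subspace `D` of) the Hilbert space `H` of the *-algebra `𝓑`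
generated by `b₁, b₂, …` subject to the canonical commutation relations; `b n` and `bstar n` are
the images of `b_{n+1}` and `b_{n+1}^*`. -/
structure BosonRep (H : Type u) [NormedAddCommGroup H] [InnerProductSpace ℂ H]
    [CompleteSpace H] where
  /-- the dense domain -/
  D : Submodule ℂ H
  dense : Dense (D : Set H)
  /-- the annihilation operators -/
  b : ℕ → Module.End ℂ D
  /-- the creation operators -/
  bstar : ℕ → Module.End ℂ D
  adjoint : ∀ n (x y : D), ⟪(bstar n x : H), (y : H)⟫_ℂ = ⟪(x : H), (b n y : H)⟫_ℂ
  comm_b_bstar : ∀ n m, b n * bstar m - bstar m * b n = if n = m then 1 else 0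
  comm_b : ∀ n m, b n * b m - b m * b n = 0
  comm_bstar : ∀ n m, bstar n * bstar m - bstar m * bstar n = 0

namespace BosonRep

variable {H : Type u} [NormedAddCommGroup H] [InnerProductSpace ℂ H] [CompleteSpace H]
variable {K : Type v} [NormedAddCommGroup K] [InnerProductSpace ℂ K] [CompleteSpace K]

/-- `Ω ∈ D` is cyclic: `π(𝓑) Ω = D`. -/
def IsCyclicVector (σ : BosonRep H) (Ω : σ.D) : Prop :=
  ∀ v : σ.D, ∃ x ∈ Algebra.adjoin ℂ (Set.range σ.b ∪ Set.range σ.bstar), x Ω = v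

/-- The class `BF_{q,i}(lam)`. The indices `i`, `j` run over `0, …, q - 1` here, so that
`q * n + i` is the position of the mode `q (n' - 1) + i'` with `n' = n + 1`, `i' = i + 1`. -/
def IsBF (q : ℕ) (i : Fin q) (lam : ℝ) (σ : BosonRep H) : Prop :=
  ∃ Ω : σ.D, Ω ≠ 0 ∧ σ.IsCyclicVector Ω ∧
    (∀ n : ℕ, σ.b (q * n + i) (σ.bstar (q * n + i) Ω) = (lam : ℂ) • Ω) ∧
    (∀ n : ℕ, ∀ j : Fin q, j ≠ i → σ.b (q * n + j) Ω = 0)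

/-- Unitary equivalence: a unitary that carries the domain of `σ` onto the domain of `τ` and
intertwines the two actions. -/
def UnitaryEquiv (σ : BosonRep H) (τ : BosonRep K) : Prop :=
  ∃ (U : H ≃ₗᵢ[ℂ] K) (hU : ∀ x : H, x ∈ σ.D ↔ U x ∈ τ.D),
    ∀ (n : ℕ) (x : σ.D),
      U (σ.b n x : H) = (τ.b n ⟨U x, (hU x).1 x.2⟩ : K) ∧
      U (σ.bstar n x : H) = (τ.bstar n ⟨U x, (hU x).1 x.2⟩ : K)

/-- `σ` is given by the recursive boson system of the family `s`:
`b₁ = ∑ₘ √m sₘ sₘ₊₁^*` and `bₙ₊₁ = ρ(bₙ) = ∑ₘ sₘ bₙ sₘ^*`, the sums converging pointwise on the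
domain of `σ`, which is `D`. -/
structure IsRBS (s : ℕ → (H →L[ℂ] H)) (D : Submodule ℂ H) (σ : BosonRep H) : Prop where
  domain_eq : σ.D = D
  star_mem : ∀ (m : ℕ) (x : σ.D), star (s m) (x : H) ∈ σ.D
  b_zero : ∀ x : σ.D,
    HasSum (fun m : ℕ => (Real.sqrt ((m : ℝ) + 1) : ℂ) • s m (star (s (m + 1)) (x : H)))
      (σ.b 0 x : H)
  b_succ : ∀ (n : ℕ) (x : σ.D),
    HasSum (fun m : ℕ => s m (σ.b n ⟨star (s m) (x : H), star_mem m x⟩ : H))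
      (σ.b (n + 1) x : H)

section DirectSum

variable {ι : Type} {L : ι → Type u} [∀ i, NormedAddCommGroup (L i)]
  [∀ i, InnerProductSpace ℂ (L i)] [∀ i, CompleteSpace (L i)]

/-- The algebraic direct sum of the domains, inside the Hilbert space direct sum. -/
def sumDomain (σ : ∀ i, BosonRep (L i)) : Submodule ℂ (PiLp 2 L) where
  carrier := {x | ∀ i, x i ∈ (σ i).D}
  add_mem' := fun hx hy i => (σ i).D.add_mem (hx i) (hy i)
  zero_mem' := fun i => (σ i).D.zero_mem
  smul_mem' := fun c _ hx i => (σ i).D.smul_mem c (hx i)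

/-- Componentwise action of operators on the direct sum of the domains. -/
def sumEnd (σ : ∀ i, BosonRep (L i)) (T : ∀ i, Module.End ℂ (σ i).D) :
    Module.End ℂ (sumDomain σ) where
  toFun x := ⟨WithLp.toLp 2 fun i => (T i ⟨x.1 i, x.2 i⟩ : L i), fun i => (T i ⟨x.1 i, x.2 i⟩).2⟩
  map_add' x y := by
    ext i
    exact congrArg Subtype.val ((T i).map_add ⟨x.1 i, x.2 i⟩ ⟨y.1 i, y.2 i⟩)
  map_smul' c x := by
    ext i
    exact congrArg Subtype.val ((T i).map_smul c ⟨x.1 i, x.2 i⟩)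

theorem sumEnd_mul (σ : ∀ i, BosonRep (L i)) (S T : ∀ i, Module.End ℂ (σ i).D) :
    sumEnd σ S * sumEnd σ T = sumEnd σ fun i => S i * T i := rfl

theorem sumEnd_sub (σ : ∀ i, BosonRep (L i)) (S T : ∀ i, Module.End ℂ (σ i).D) :
    sumEnd σ S - sumEnd σ T = sumEnd σ fun i => S i - T i := rfl

theorem sumEnd_one (σ : ∀ i, BosonRep (L i)) : (sumEnd σ fun _ => 1) = 1 := rfl

theorem sumEnd_zero (σ : ∀ i, BosonRep (L i)) : (sumEnd σ fun _ => 0) = 0 := rfl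

theorem sumDomain_dense (σ : ∀ i, BosonRep (L i)) : Dense (sumDomain σ : Set (PiLp 2 L)) := by
  have h : Dense (Set.pi Set.univ fun i => ((σ i).D : Set (L i))) :=
    dense_pi _ fun i _ => (σ i).dense
  have h2 := (PiLp.homeomorph 2 L).symm.surjective.denseRange.dense_image
    (PiLp.homeomorph 2 L).symm.continuous h
  refine h2.mono ?_
  rintro _ ⟨x, hx, rfl⟩ i
  exact hx i (Set.mem_univ i)

/-- The direct sum of finitely many representations of `𝓑`. -/
def directSum [Fintype ι] (σ : ∀ i, BosonRep (L i)) : BosonRep (PiLp 2 L) where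
  D := sumDomain σ
  dense := sumDomain_dense σ
  b n := sumEnd σ fun i => (σ i).b n
  bstar n := sumEnd σ fun i => (σ i).bstar n
  adjoint n x y := by
    rw [PiLp.inner_apply, PiLp.inner_apply]
    exact Finset.sum_congr rfl fun i _ => (σ i).adjoint n ⟨x.1 i, x.2 i⟩ ⟨y.1 i, y.2 i⟩
  comm_b_bstar n m := by
    rw [sumEnd_mul, sumEnd_mul, sumEnd_sub]
    simp only [comm_b_bstar]
    split_ifs <;> rfl
  comm_b n m := by
    rw [sumEnd_mul, sumEnd_mul, sumEnd_sub]
    simp only [comm_b]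
    rfl
  comm_bstar n m := by
    rw [sumEnd_mul, sumEnd_mul, sumEnd_sub]
    simp only [comm_bstar]
    rfl

end DirectSum

/-- The class `BF_{p,1}(lam) ⊕ ⋯ ⊕ BF_{p,p}(lam)`: all representations that are unitarily
equivalent to a direct sum of representations `τ i`, one from each class. -/
def IsSumBF (p : ℕ) (lam : ℝ) (σ : BosonRep H) : Prop :=
  ∃ (L : Fin p → Type u) (_ : ∀ i, NormedAddCommGroup (L i))
    (_ : ∀ i, InnerProductSpace ℂ (L i)) (_ : ∀ i, CompleteSpace (L i))
    (τ : ∀ i, BosonRep (L i)),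
    (∀ i, (τ i).IsBF p i lam) ∧ σ.UnitaryEquiv (directSum τ)

end BosonRep

/-! ### Branching laws -/

/-- A class of representations of `𝓑`. -/
abbrev BosonClass : Type (u + 1) :=
  ∀ (H : Type u) [NormedAddCommGroup H] [InnerProductSpace ℂ H] [CompleteSpace H],
    BosonRep H → Prop

/-- `BF_{q,i}(lam)` as a class. -/
def BF (q : ℕ) (i : Fin q) (lam : ℝ) : BosonClass.{u} :=
  fun _ _ _ _ σ => σ.IsBF q i lam

/-- `BF_{p,1}(lam) ⊕ ⋯ ⊕ BF_{p,p}(lam)` as a class. -/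
def SumBF (p : ℕ) (lam : ℝ) : BosonClass.{u} :=
  fun _ _ _ _ σ => σ.IsSumBF p lam

/-- `C` is the unitary equivalence class of the restriction to `𝓑`, by the recursive boson system
of `s` on the domain `D`, of a representation on `H`; in particular this restriction exists. -/
def RBSRestrictionClassEq {H : Type u} [NormedAddCommGroup H] [InnerProductSpace ℂ H]
    [CompleteSpace H] (s : ℕ → (H →L[ℂ] H)) (D : Submodule ℂ H) (C : BosonClass.{u}) : Prop :=
  ∃ σ : BosonRep H, σ.IsRBS s D ∧
    ∀ (K : Type u) [NormedAddCommGroup K] [InnerProductSpace ℂ K] [CompleteSpace K]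
      (τ : BosonRep K), C K τ ↔ τ.UnitaryEquiv σ

/-- `P_∞(J)|_𝓑 = C` as classes of representations up to unitary equivalence: the class `P_∞(J)`
is not empty, and `C` is the unitary equivalence class of the restriction of each of its members. -/
def PInftyRestrictsTo (J : List ℕ) (C : BosonClass.{u}) : Prop :=
  (∃ (H : Type u) (_ : NormedAddCommGroup H) (_ : InnerProductSpace ℂ H) (_ : CompleteSpace H)
    (s : ℕ → (H →L[ℂ] H)) (Ω : H), IsCuntzInfty s ∧ IsGPVector s J Ω) ∧
  ∀ (H : Type u) [NormedAddCommGroup H] [InnerProductSpace ℂ H] [CompleteSpace H]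
    (s : ℕ → (H →L[ℂ] H)) (Ω : H), IsCuntzInfty s → IsGPVector s J Ω →
    RBSRestrictionClassEq s (orbitSpan s Ω) C

/-- `P₂(J)|_𝓑 = C` as classes of representations up to unitary equivalence: the class `P₂(J)`
is not empty, and `C` is the unitary equivalence class of the restriction of each of its members,
where `𝓞_∞` is embedded into `𝓞₂` by `s_m = t₂^{m-1} t₁`. -/
def PTwoRestrictsTo (J : List (Fin 2)) (C : BosonClass.{u}) : Prop :=
  (∃ (H : Type u) (_ : NormedAddCommGroup H) (_ : InnerProductSpace ℂ H) (_ : CompleteSpace H)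
    (t : Fin 2 → (H →L[ℂ] H)) (Ω : H), IsCuntzTwo t ∧ IsGPVector t J Ω) ∧
  ∀ (H : Type u) [NormedAddCommGroup H] [InnerProductSpace ℂ H] [CompleteSpace H]
    (t : Fin 2 → (H →L[ℂ] H)) (Ω : H), IsCuntzTwo t → IsGPVector t J Ω →
    RBSRestrictionClassEq (cuntzEmbedding t) (orbitSpan t Ω) C

/-! All three laws rest on one invariant. A representation satisfies `HasFock X` if it has an
orthonormal basis of occupation number vectors, indexed by a set `X` of sequences of naturals, that
spans its domain algebraically. Matching two such bases shows that representations with the same `X`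
are unitarily equivalent, and `HasFock X` passes along unitary equivalences. So a class described by
`HasFock X` is the equivalence class of any of its members, and each law becomes an equality of
index sets.

Boson side. The cyclic vector of $BF_{q,i}(c+1)$ is a joint eigenvector of all number operators,
with eigenvalue `c` in the modes congruent to `i` mod `q` and `0` in the others. Ladder operators in
finitely many modes turn it into a basis indexed by the sequences that eventually agree with these
eigenvalues (`hasFock_of_cyclic`, `isBF_iff_hasFock`). For `c ≠ 0` the index sets for different `i`
are disjoint, and a direct sum has their union as index set (`isSumBF_iff_hasFock`).

Cuntz side. If `J` is aperiodic, the orbit of the GP vector is spanned by orthonormal vectors $e_x$,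
where `x` shares a tail with $JJJ\cdots$ and $s_i e_x = e_{ix}$ (`exists_seq_basis`). The first
boson operator lowers the first letter of `x`, and the recursion shifts this to every position. With
letters counted from `0`, the letters are therefore the occupation numbers (`exists_isRBS_hasFock`).

The two sides meet in `tailClass_replicate_append`: sharing a tail with $(0^k c)^\infty$ means
eventually agreeing with one of its `k + 1` cyclic shifts. The $\mathcal O_2$ laws reduce to words
of this form by replacing the GP vector `Ω` with the vector `Ω'` such that $t_1\Omega'=\Omega$. It
is fixed by a word in the $s_m$, and its orbit under them spans the same domain. Shift operators on
$\ell^2$ of a tail class show that the classes are not empty. -/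

namespace BosonRep

/-! ### Occupation number bases and unitary equivalence -/

variable {H : Type u} [NormedAddCommGroup H] [InnerProductSpace ℂ H] [CompleteSpace H]
variable {K : Type v} [NormedAddCommGroup K] [InnerProductSpace ℂ K] [CompleteSpace K]

/-- The vectors `e x` span the domain and the boson operators act on them as on the occupation
number vectors of Fock space. -/
structure HasLadder (σ : BosonRep H) (e : (ℕ → ℕ) → σ.D) : Prop where
  span : Submodule.span ℂ (Set.range e) = ⊤
  b_apply : ∀ n x, σ.b n (e x) = (Real.sqrt (x n) : ℂ) • e (Function.update x n (x n - 1))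
  bstar_apply : ∀ n x,
    σ.bstar n (e x) = (Real.sqrt (x n + 1) : ℂ) • e (Function.update x n (x n + 1))

/-- `e` restricts to an orthonormal occupation number basis indexed by the set `X`, and vanishes
outside `X`. -/
structure IsFockFamily (σ : BosonRep H) (X : Set (ℕ → ℕ)) (e : (ℕ → ℕ) → σ.D) : Prop
    extends HasLadder σ e where
  zero : ∀ x ∉ X, e x = 0
  norm : ∀ x ∈ X, ‖(e x : H)‖ = 1

/-- `σ` has an occupation number basis indexed by the set `X` of occupation sequences. -/
def HasFock (X : Set (ℕ → ℕ)) (σ : BosonRep H) : Prop :=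
  ∃ e, σ.IsFockFamily X e

theorem adjoint' (σ : BosonRep H) (n : ℕ) (x y : σ.D) :
    ⟪(σ.b n x : H), (y : H)⟫_ℂ = ⟪(x : H), (σ.bstar n y : H)⟫_ℂ := by
  rw [← inner_conj_symm, ← σ.adjoint, inner_conj_symm]

theorem b_bstar_apply (σ : BosonRep H) (n m : ℕ) (v : σ.D) :
    σ.b n (σ.bstar m v) = σ.bstar m (σ.b n v) + if n = m then v else 0 := by
  have h := LinearMap.congr_fun (σ.comm_b_bstar n m) v
  simp only [LinearMap.sub_apply, Module.End.mul_apply] at h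
  rw [sub_eq_iff_eq_add'] at h
  rw [h]
  split_ifs <;> simp

theorem ofReal_sqrt_mul_self {r : ℝ} (hr : 0 ≤ r) :
    (Real.sqrt r : ℂ) * (Real.sqrt r : ℂ) = (r : ℂ) := by
  rw [← Complex.ofReal_mul, Real.mul_self_sqrt hr]

namespace HasLadder

variable {σ : BosonRep H} {e : (ℕ → ℕ) → σ.D}

theorem b_bstar (h : σ.HasLadder e) (n : ℕ) (x : ℕ → ℕ) :
    σ.b n (σ.bstar n (e x)) = ((x n : ℂ) + 1) • e x := by
  rw [h.bstar_apply, map_smul, h.b_apply, smul_smul]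
  simp only [Function.update_self, Function.update_idem, Nat.add_sub_cancel,
    Function.update_eq_self]
  push_cast
  rw [ofReal_sqrt_mul_self (by positivity)]
  push_cast; rfl

theorem bstar_b (h : σ.HasLadder e) (n : ℕ) (x : ℕ → ℕ) :
    σ.bstar n (σ.b n (e x)) = (x n : ℂ) • e x := by
  have h1 := σ.b_bstar_apply n n (e x)
  rw [h.b_bstar, if_pos rfl, add_smul, one_smul] at h1
  exact (add_right_cancel h1).symm

/-- The two vectors are eigenvectors of a symmetric number operator with different eigenvalues. -/
theorem inner_eq_zero (h : σ.HasLadder e) {x y : ℕ → ℕ} (hxy : x ≠ y) :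
    ⟪(e x : H), (e y : H)⟫_ℂ = 0 := by
  obtain ⟨n, hn⟩ := Function.ne_iff.1 hxy
  have h1 : ⟪(σ.bstar n (σ.b n (e x)) : H), (e y : H)⟫_ℂ
      = ⟪(e x : H), (σ.bstar n (σ.b n (e y)) : H)⟫_ℂ := by
    rw [σ.adjoint, σ.adjoint']
  rw [h.bstar_b, h.bstar_b, Submodule.coe_smul, Submodule.coe_smul, inner_smul_left,
    inner_smul_right, Complex.conj_natCast] at h1
  have h2 : ((x n : ℂ) - y n) * ⟪(e x : H), (e y : H)⟫_ℂ = 0 := by rw [sub_mul, h1, sub_self]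
  rcases mul_eq_zero.1 h2 with h3 | h3
  · exact absurd (by exact_mod_cast sub_eq_zero.1 h3) hn
  · exact h3

/-- Both sides come from computing the squared norm of `bstar n (e x)`, once directly and once by
the adjoint relation. -/
theorem norm_update_succ (h : σ.HasLadder e) (n : ℕ) (x : ℕ → ℕ) :
    ‖(e (Function.update x n (x n + 1)) : H)‖ = ‖(e x : H)‖ := by
  have h1 : ⟪(σ.bstar n (e x) : H), (σ.bstar n (e x) : H)⟫_ℂ
      = ⟪(e x : H), (σ.b n (σ.bstar n (e x)) : H)⟫_ℂ := σ.adjoint _ _ _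
  rw [h.b_bstar, h.bstar_apply, Submodule.coe_smul, Submodule.coe_smul, inner_smul_left,
    inner_smul_right, inner_smul_right, Complex.conj_ofReal, ← mul_assoc,
    ofReal_sqrt_mul_self (by positivity), inner_self_eq_norm_sq_to_K, inner_self_eq_norm_sq_to_K]
    at h1
  push_cast at h1
  have h2 := mul_left_cancel₀ (by exact_mod_cast Nat.succ_ne_zero (x n)) h1
  have h3 : ‖(e (Function.update x n (x n + 1)) : H)‖ ^ 2 = ‖(e x : H)‖ ^ 2 := by exact_mod_cast h2
  exact (sq_eq_sq₀ (norm_nonneg _) (norm_nonneg _)).1 h3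

theorem norm_update (h : σ.HasLadder e) (n j : ℕ) (x : ℕ → ℕ) :
    ‖(e (Function.update x n j) : H)‖ = ‖(e x : H)‖ := by
  have key : ∀ j, ‖(e (Function.update x n j) : H)‖ = ‖(e (Function.update x n 0) : H)‖ := by
    intro j
    induction j with
    | zero => rfl
    | succ j ih =>
      rw [← ih, ← h.norm_update_succ n (Function.update x n j)]
      simp
  rw [key j, ← key (x n), Function.update_eq_self]

end HasLadder

theorem span_coe_eq {σ : BosonRep H} {e : (ℕ → ℕ) → σ.D}
    (h : Submodule.span ℂ (Set.range e) = ⊤) :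
    Submodule.span ℂ (Set.range fun x => (e x : H)) = σ.D := by
  have := congrArg (Submodule.map σ.D.subtype) h
  rw [Submodule.map_span, ← Set.range_comp, Submodule.map_top, Submodule.range_subtype] at this
  exact this

namespace IsFockFamily

variable {σ : BosonRep H} {X : Set (ℕ → ℕ)} {e : (ℕ → ℕ) → σ.D}

theorem orthonormal (h : σ.IsFockFamily X e) : Orthonormal ℂ fun x : X => (e x : H) :=
  ⟨fun x => h.norm x x.2, fun _ _ hxy =>
    h.toHasLadder.inner_eq_zero fun hc => hxy (Subtype.ext hc)⟩

theorem span_restrict (h : σ.IsFockFamily X e) :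
    Submodule.span ℂ (Set.range fun x : X => (e x : H)) = σ.D := by
  refine Eq.trans ?_ (span_coe_eq h.span)
  apply le_antisymm
  · apply Submodule.span_mono
    rintro _ ⟨x, rfl⟩
    exact ⟨x, rfl⟩
  · rw [Submodule.span_le]
    rintro _ ⟨x, rfl⟩
    by_cases hx : x ∈ X
    · exact Submodule.subset_span ⟨⟨x, hx⟩, rfl⟩
    · simp [h.zero x hx]

/-- The occupation number basis as a Hilbert basis. -/
noncomputable def hilbertBasis (h : σ.IsFockFamily X e) : HilbertBasis X ℂ H :=
  HilbertBasis.mk h.orthonormal (by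
    rw [h.span_restrict]
    intro x _
    exact σ.dense x)

theorem hilbertBasis_apply (h : σ.IsFockFamily X e) (x : X) : h.hilbertBasis x = (e x : H) := by
  simp [hilbertBasis]

/-- Two representations with occupation number bases indexed by the same set are equivalent. -/
theorem unitaryEquiv (h : σ.IsFockFamily X e) {τ : BosonRep K} {f : (ℕ → ℕ) → τ.D}
    (h' : τ.IsFockFamily X f) : σ.UnitaryEquiv τ := by
  classical
  -- The unitary matches the two Hilbert bases index by index; since both bases span the domains
  -- algebraically, it also carries domain onto domain.
  let U : H ≃ₗᵢ[ℂ] K := h.hilbertBasis.repr.trans h'.hilbertBasis.repr.symm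
  have hU : ∀ x, U (e x) = (f x : K) := by
    intro x
    by_cases hx : x ∈ X
    · have h1 := h.hilbertBasis_apply ⟨x, hx⟩
      have h2 := h'.hilbertBasis_apply ⟨x, hx⟩
      simp only at h1 h2
      rw [← h1, ← h2]
      change h'.hilbertBasis.repr.symm (h.hilbertBasis.repr (h.hilbertBasis ⟨x, hx⟩)) = _
      rw [HilbertBasis.repr_self, HilbertBasis.repr_symm_single]
    · simp [h.zero x hx, h'.zero x hx]
  have hD : σ.D.map (U : H →ₗ[ℂ] K) = τ.D := by
    rw [← span_coe_eq h.span, ← span_coe_eq h'.span, Submodule.map_span, ← Set.range_comp]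
    congr 2
    ext1 x
    exact hU x
  have hmem : ∀ x : H, x ∈ σ.D ↔ U x ∈ τ.D := by
    intro x
    rw [← hD]
    constructor
    · exact fun hx => ⟨x, hx, rfl⟩
    · rintro ⟨y, hy, hyx⟩
      rwa [← U.injective hyx]
  let V : σ.D →ₗ[ℂ] τ.D := (U : H →ₗ[ℂ] K).restrict fun x hx => (hmem x).1 hx
  have hV : ∀ x, V (e x) = f x := fun x => Subtype.ext (hU x)
  refine ⟨U, hmem, fun n x => ?_⟩
  have hb : V ∘ₗ σ.b n = τ.b n ∘ₗ V := by
    refine LinearMap.ext_on h.span ?_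
    rintro _ ⟨x, rfl⟩
    simp [hV, h.b_apply, h'.b_apply]
  have hbs : V ∘ₗ σ.bstar n = τ.bstar n ∘ₗ V := by
    refine LinearMap.ext_on h.span ?_
    rintro _ ⟨x, rfl⟩
    simp [hV, h.bstar_apply, h'.bstar_apply]
  exact ⟨congrArg Subtype.val (LinearMap.congr_fun hb x),
    congrArg Subtype.val (LinearMap.congr_fun hbs x)⟩

end IsFockFamily

theorem HasFock.unitaryEquiv {X : Set (ℕ → ℕ)} {σ : BosonRep H} {τ : BosonRep K}
    (h : σ.HasFock X) (h' : τ.HasFock X) : σ.UnitaryEquiv τ := by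
  obtain ⟨e, he⟩ := h
  obtain ⟨f, hf⟩ := h'
  exact he.unitaryEquiv hf

theorem HasFock.of_unitaryEquiv {X : Set (ℕ → ℕ)} {σ : BosonRep H} {τ : BosonRep K}
    (h : τ.HasFock X) (h' : σ.UnitaryEquiv τ) : σ.HasFock X := by
  obtain ⟨e, he⟩ := h
  obtain ⟨U, hU, hi⟩ := h'
  have hmem : ∀ y : τ.D, U.symm (y : K) ∈ σ.D := fun y => by
    rw [hU, U.apply_symm_apply]; exact y.2
  let V : σ.D ≃ₗ[ℂ] τ.D := LinearEquiv.ofSubmodules U.toLinearEquiv σ.D τ.D (by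
    ext y
    constructor
    · rintro ⟨x, hx, rfl⟩
      exact (hU x).1 hx
    · exact fun hy => ⟨U.symm y, hmem ⟨y, hy⟩, U.apply_symm_apply y⟩)
  have hVb : ∀ n y, σ.b n (V.symm y) = V.symm (τ.b n y) := fun n y => by
    rw [LinearEquiv.eq_symm_apply]
    refine Subtype.ext ((hi n (V.symm y)).1.trans ?_)
    congr 2
    exact V.apply_symm_apply y
  have hVbs : ∀ n y, σ.bstar n (V.symm y) = V.symm (τ.bstar n y) := fun n y => by
    rw [LinearEquiv.eq_symm_apply]
    refine Subtype.ext ((hi n (V.symm y)).2.trans ?_)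
    congr 2
    exact V.apply_symm_apply y
  refine ⟨fun x => V.symm (e x), ⟨⟨?_, fun n x => ?_, fun n x => ?_⟩, fun x hx => ?_,
    fun x hx => ?_⟩⟩
  · have : (Set.range fun x => V.symm (e x)) = (V.symm : τ.D →ₗ[ℂ] σ.D) '' Set.range e := by
      rw [← Set.range_comp]; rfl
    rw [this, ← Submodule.map_span, he.span, Submodule.map_top, LinearEquiv.range]
  · rw [hVb, he.b_apply, map_smul]
  · rw [hVbs, he.bstar_apply, map_smul]
  · rw [he.zero x hx, map_zero]
  · rw [← he.norm x hx]
    exact U.symm.norm_map _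

end BosonRep

/-! ### Construction of representations from orthonormal families -/

namespace BosonRep

variable {H : Type u} [NormedAddCommGroup H] [InnerProductSpace ℂ H] [CompleteSpace H]

/-- Orthonormal vectors indexed by a set of sequences that is closed under modification of single
entries are the occupation number basis of a representation of `𝓑`. -/
theorem exists_isFockFamily {X : Set (ℕ → ℕ)}
    (hX : ∀ x n j, Function.update x n j ∈ X ↔ x ∈ X) (e : (ℕ → ℕ) → H)
    (hzero : ∀ x ∉ X, e x = 0) (hnorm : ∀ x ∈ X, ‖e x‖ = 1)
    (horth : ∀ x y, x ≠ y → ⟪e x, e y⟫_ℂ = 0)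
    (hdense : Dense (Submodule.span ℂ (Set.range e) : Set H)) :
    ∃ (σ : BosonRep H) (f : (ℕ → ℕ) → σ.D), σ.IsFockFamily X f ∧ (∀ x, (f x : H) = e x) ∧
      σ.D = Submodule.span ℂ (Set.range e) := by
  classical
  have hon : Orthonormal ℂ (fun x : X => e x) :=
    ⟨fun x => hnorm x x.2, fun x y hxy => horth _ _ fun hc => hxy (Subtype.ext hc)⟩
  have hspan : Submodule.span ℂ (Set.range fun x : X => e x)
      = Submodule.span ℂ (Set.range e) := by
    apply le_antisymm
    · apply Submodule.span_mono
      rintro _ ⟨x, rfl⟩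
      exact ⟨x, rfl⟩
    · rw [Submodule.span_le]
      rintro _ ⟨x, rfl⟩
      by_cases hx : x ∈ X
      · exact Submodule.subset_span ⟨⟨x, hx⟩, rfl⟩
      · simp [hzero x hx]
  generalize hD : Submodule.span ℂ (Set.range e) = D at hdense hspan ⊢
  let B : Module.Basis X ℂ D := (Module.Basis.span hon.linearIndependent).map
    (LinearEquiv.ofEq _ _ hspan)
  have hB : ∀ x : X, (B x : H) = e x := fun x => by simp [B, Module.Basis.span_apply]
  let f : (ℕ → ℕ) → D := fun x => if h : x ∈ X then B ⟨x, h⟩ else 0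
  have hf : ∀ x, (f x : H) = e x := fun x => by
    by_cases hx : x ∈ X
    · simp [f, hx, hB]
    · simp [f, hx, hzero]
  have hf0 : ∀ x ∉ X, f x = 0 := fun x hx => Subtype.ext ((hf x).trans (hzero x hx))
  have hfB : ∀ x : X, f x = B x := fun x => Subtype.ext ((hf x).trans (hB x).symm)
  have hfspan : Submodule.span ℂ (Set.range f) = ⊤ := by
    rw [eq_top_iff, ← B.span_eq]
    apply Submodule.span_mono
    rintro _ ⟨x, rfl⟩
    exact ⟨x, hfB x⟩
  have hext : ∀ S T : Module.End ℂ D, (∀ x, S (f x) = T (f x)) → S = T := fun S T h => by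
    refine LinearMap.ext_on hfspan ?_
    rintro _ ⟨x, rfl⟩
    exact h x
  let b : ℕ → Module.End ℂ D := fun n =>
    B.constr ℂ fun x => (Real.sqrt (x.1 n) : ℂ) • f (Function.update x.1 n (x.1 n - 1))
  let bs : ℕ → Module.End ℂ D := fun n =>
    B.constr ℂ fun x => (Real.sqrt (x.1 n + 1) : ℂ) • f (Function.update x.1 n (x.1 n + 1))
  have hb : ∀ n x, b n (f x) = (Real.sqrt (x n) : ℂ) • f (Function.update x n (x n - 1)) := by
    intro n x
    by_cases hx : x ∈ X
    · rw [hfB ⟨x, hx⟩]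
      exact B.constr_basis ℂ _ _
    · rw [hf0 x hx, hf0 _ (by rwa [hX]), map_zero, smul_zero]
  have hbs : ∀ n x,
      bs n (f x) = (Real.sqrt (x n + 1) : ℂ) • f (Function.update x n (x n + 1)) := by
    intro n x
    by_cases hx : x ∈ X
    · rw [hfB ⟨x, hx⟩]
      exact B.constr_basis ℂ _ _
    · rw [hf0 x hx, hf0 _ (by rwa [hX]), map_zero, smul_zero]
  have hbbs : ∀ n x, b n (bs n (f x)) = ((x n : ℂ) + 1) • f x := fun n x => by
    rw [hbs, map_smul, hb, smul_smul]
    simp only [Function.update_self, Function.update_idem, Nat.add_sub_cancel,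
      Function.update_eq_self]
    push_cast
    rw [ofReal_sqrt_mul_self (by positivity)]
    push_cast; rfl
  have hbsb : ∀ n x, bs n (b n (f x)) = (x n : ℂ) • f x := fun n x => by
    rw [hb, map_smul, hbs, smul_smul]
    rcases Nat.eq_zero_or_pos (x n) with h0 | h0
    · simp [h0]
    · simp only [Function.update_self, Function.update_idem, Nat.sub_add_cancel h0,
        Function.update_eq_self, Nat.cast_pred h0, sub_add_cancel]
      rw [ofReal_sqrt_mul_self (by positivity)]
      push_cast; rfl
  have hadj : ∀ n (x y : D), ⟪(bs n x : H), (y : H)⟫_ℂ = ⟪(x : H), (b n y : H)⟫_ℂ := by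
    intro n x y
    have hx : x ∈ Submodule.span ℂ (Set.range f) := hfspan ▸ Submodule.mem_top
    have hy : y ∈ Submodule.span ℂ (Set.range f) := hfspan ▸ Submodule.mem_top
    induction hx, hy using Submodule.span_induction₂ with
    | mem_mem x y hx hy =>
      obtain ⟨x, rfl⟩ := hx
      obtain ⟨y, rfl⟩ := hy
      rw [hb, hbs, Submodule.coe_smul, Submodule.coe_smul, hf, hf, hf, hf, inner_smul_left,
        inner_smul_right, Complex.conj_ofReal]
      -- Both matrix entries vanish unless `y` is `x` raised by one at `n`. When `y n = 0` the
      -- truncated subtraction does not invert raising, but its coefficient is zero.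
      by_cases hxy : Function.update x n (x n + 1) = y
      · subst hxy
        simp only [Function.update_self, Function.update_idem, Nat.add_sub_cancel,
          Function.update_eq_self, inner_self_eq_norm_sq_to_K]
        by_cases hxX : x ∈ X
        · rw [hnorm x hxX, hnorm _ (by rwa [hX])]
          push_cast; rfl
        · rw [hzero x hxX, hzero _ (by rwa [hX])]
          simp
      · rw [horth _ _ hxy, mul_zero]
        rcases Nat.eq_zero_or_pos (y n) with h0 | h0
        · simp [h0]
        · rw [horth _ _ ?_, mul_zero]
          rintro rfl
          apply hxy
          simp [Nat.sub_add_cancel h0]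
    | zero_left y hy => simp
    | zero_right x hx => simp
    | add_left x y z _ _ _ h1 h2 =>
      simp only [map_add, Submodule.coe_add, inner_add_left, h1, h2]
    | add_right x y z _ _ _ h1 h2 =>
      simp only [map_add, Submodule.coe_add, inner_add_right, h1, h2]
    | smul_left r x y _ _ h => simp only [map_smul, Submodule.coe_smul, inner_smul_left, h]
    | smul_right r x y _ _ h => simp only [map_smul, Submodule.coe_smul, inner_smul_right, h]
  let σ : BosonRep H :=
    { D := D
      dense := hdense
      b := b
      bstar := bs
      adjoint := hadj
      comm_b_bstar := fun n m => by
        apply hext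
        intro x
        rw [LinearMap.sub_apply, Module.End.mul_apply, Module.End.mul_apply]
        split_ifs with hnm
        · subst hnm
          rw [hbbs, hbsb, add_smul, add_sub_cancel_left, one_smul, Module.End.one_apply]
        · rw [hbs, hb, map_smul, map_smul, hb, hbs, smul_smul, smul_smul,
            Function.update_of_ne hnm, Function.update_of_ne (Ne.symm hnm),
            Function.update_comm hnm, mul_comm, sub_self, LinearMap.zero_apply]
      comm_b := fun n m => by
        apply hext
        intro x
        rw [LinearMap.sub_apply, Module.End.mul_apply, Module.End.mul_apply]
        by_cases hnm : n = m
        · simp [hnm]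
        · rw [hb, hb, map_smul, map_smul, hb, hb, smul_smul, smul_smul,
            Function.update_of_ne hnm, Function.update_of_ne (Ne.symm hnm),
            Function.update_comm hnm, mul_comm, sub_self, LinearMap.zero_apply]
      comm_bstar := fun n m => by
        apply hext
        intro x
        rw [LinearMap.sub_apply, Module.End.mul_apply, Module.End.mul_apply]
        by_cases hnm : n = m
        · simp [hnm]
        · rw [hbs, hbs, map_smul, map_smul, hbs, hbs, smul_smul, smul_smul,
            Function.update_of_ne hnm, Function.update_of_ne (Ne.symm hnm),
            Function.update_comm hnm, mul_comm, sub_self, LinearMap.zero_apply] }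
  refine ⟨σ, f, ⟨⟨hfspan, hb, hbs⟩, hf0, fun x hx => ?_⟩, hf, rfl⟩
  rw [hf, hnorm x hx]

/-- The standard Hilbert space with orthonormal basis indexed by a set. -/
abbrev SeqSpace {α : Type} (X : Set α) : Type u := lp (fun _ : ULift.{u} X => ℂ) 2

/-- The standard basis vectors, extended by zero outside the index set. -/
noncomputable def stdVec {α : Type} (X : Set α) (x : α) : SeqSpace.{u} X :=
  open Classical in if h : x ∈ X then lp.single 2 ⟨⟨x, h⟩⟩ (1 : ℂ) else 0

theorem norm_stdVec {α : Type} {X : Set α} {x : α} (h : x ∈ X) :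
    ‖(stdVec X x : SeqSpace.{u} X)‖ = 1 := by
  classical
  rw [stdVec, dif_pos h, lp.norm_single (by norm_num)]
  simp

theorem stdVec_of_notMem {α : Type} {X : Set α} {x : α} (h : x ∉ X) :
    (stdVec X x : SeqSpace.{u} X) = 0 := by
  rw [stdVec, dif_neg h]

theorem inner_stdVec {α : Type} {X : Set α} {x y : α} (h : x ≠ y) :
    ⟪(stdVec X x : SeqSpace.{u} X), stdVec X y⟫_ℂ = 0 := by
  classical
  by_cases hx : x ∈ X
  · by_cases hy : y ∈ X
    · rw [stdVec, stdVec, dif_pos hx, dif_pos hy, lp.inner_single_left, lp.single_apply_ne]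
      · simp
      · simpa using h
    · rw [stdVec_of_notMem hy, inner_zero_right]
  · rw [stdVec_of_notMem hx, inner_zero_left]

theorem dense_span_stdVec {α : Type} (X : Set α) :
    Dense (Submodule.span ℂ (Set.range (stdVec X : α → SeqSpace.{u} X)) : Set (SeqSpace.{u} X)) := by
  classical
  let b : HilbertBasis (ULift.{u} X) ℂ (SeqSpace.{u} X) :=
    HilbertBasis.ofRepr (LinearIsometryEquiv.refl ℂ _)
  have h := b.dense_span
  rw [← Submodule.dense_iff_topologicalClosure_eq_top] at h
  refine h.mono (Submodule.span_mono ?_)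
  rintro _ ⟨⟨x, hx⟩, rfl⟩
  refine ⟨x, ?_⟩
  rw [stdVec, dif_pos hx]
  exact (b.repr_symm_single _)

/-- Supplies the summands when a member of a direct sum of classes has to be produced. -/
theorem exists_hasFock {X : Set (ℕ → ℕ)} (hX : ∀ x n j, Function.update x n j ∈ X ↔ x ∈ X) :
    ∃ σ : BosonRep (SeqSpace.{u} X), σ.HasFock X := by
  obtain ⟨σ, f, h, -⟩ := exists_isFockFamily hX (stdVec X) (fun _ => stdVec_of_notMem)
    (fun _ => norm_stdVec) (fun _ _ => inner_stdVec) (dense_span_stdVec X)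
  exact ⟨σ, f, h⟩

/-! ### Direct sums -/

section DirectSum

variable {ι : Type} [Fintype ι] {L : ι → Type u} [∀ i, NormedAddCommGroup (L i)]
  [∀ i, InnerProductSpace ℂ (L i)] [∀ i, CompleteSpace (L i)]

theorem HasFock.directSum {σ : ∀ i, BosonRep (L i)} {X : ι → Set (ℕ → ℕ)}
    (hX : Pairwise fun i j => Disjoint (X i) (X j)) (h : ∀ i, (σ i).HasFock (X i)) :
    (directSum σ).HasFock (⋃ i, X i) := by
  classical
  choose e he using h
  let f : (ℕ → ℕ) → (BosonRep.directSum σ).D := fun x =>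
    ⟨WithLp.toLp 2 fun i => (e i x : L i), fun i => (e i x).2⟩
  -- Disjointness leaves each `x` with at most one nonzero component, so `f x` is a basis vector of
  -- a single summand.
  have hf : ∀ i, ∀ x ∈ X i, (f x : PiLp 2 L) = PiLp.single 2 i (e i x : L i) := by
    intro i x hx
    ext j
    by_cases hij : j = i
    · subst hij; simp [f]
    · have : x ∉ X j := fun hc => Set.disjoint_left.1 (hX hij) hc hx
      simp [f, hij, (he j).zero x this]
  refine ⟨f, ⟨⟨?_, fun n x => ?_, fun n x => ?_⟩, fun x hx => ?_, fun x hx => ?_⟩⟩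
  · rw [eq_top_iff]
    rintro v -
    let ins : ∀ i, (σ i).D →ₗ[ℂ] (BosonRep.directSum σ).D := fun i =>
      { toFun := fun w => ⟨PiLp.single 2 i (w : L i), fun j => by
          by_cases hij : j = i
          · subst hij; simp
          · simp [hij]⟩
        map_add' := fun w w' => Subtype.ext (by ext j; by_cases hij : j = i <;> [subst hij; skip] <;> simp_all)
        map_smul' := fun c w => Subtype.ext (by ext j; by_cases hij : j = i <;> [subst hij; skip] <;> simp_all) }
    have hv : v = ∑ i, ins i ⟨v.1 i, v.2 i⟩ := by
      refine Subtype.ext ?_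
      ext j
      simp [ins]
    rw [hv]
    refine Submodule.sum_mem _ fun i _ => ?_
    have h1 : (⟨v.1 i, v.2 i⟩ : (σ i).D) ∈ Submodule.span ℂ (Set.range (e i)) := by
      rw [(he i).span]; trivial
    have h2 := Submodule.mem_map_of_mem (f := ins i) h1
    rw [Submodule.map_span] at h2
    refine Submodule.span_le.2 ?_ h2
    rintro _ ⟨_, ⟨x, rfl⟩, rfl⟩
    by_cases hx : x ∈ X i
    · exact Submodule.subset_span ⟨x, Subtype.ext (hf i x hx)⟩
    · rw [(he i).zero x hx, map_zero]
      exact zero_mem _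
  · refine Subtype.ext ?_
    ext i
    exact congrArg Subtype.val ((he i).b_apply n x)
  · refine Subtype.ext ?_
    ext i
    exact congrArg Subtype.val ((he i).bstar_apply n x)
  · refine Subtype.ext ?_
    ext i
    rw [Set.mem_iUnion, not_exists] at hx
    simp [f, (he i).zero x (hx i)]
  · obtain ⟨i, hi⟩ := Set.mem_iUnion.1 hx
    rw [hf i x hi, PiLp.norm_single, (he i).norm x hi]

end DirectSum

end BosonRep

/-! ### Ladder operators and cyclic vectors -/

namespace BosonRep

variable {H : Type u} [NormedAddCommGroup H] [InnerProductSpace ℂ H] [CompleteSpace H]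

section OneMode

variable {σ : BosonRep H} {n : ℕ} {a : ℕ} {v : σ.D}

theorem number_b_pow (hv : σ.bstar n (σ.b n v) = (a : ℂ) • v) (k : ℕ) :
    σ.bstar n (σ.b n ((σ.b n ^ k) v)) = ((a : ℂ) - k) • (σ.b n ^ k) v := by
  induction k with
  | zero => simpa using hv
  | succ k ih =>
    have h := σ.b_bstar_apply n n (σ.b n ((σ.b n ^ k) v))
    rw [ih, if_pos rfl, map_smul] at h
    rw [pow_succ', Module.End.mul_apply, ← sub_eq_iff_eq_add.2 h]
    push_cast
    module

/-- After `a` lowerings the number eigenvalue is `0`, and $\|b w\|^2=\langle w, b^*b w\rangle$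
forces `b w = 0`. This is where positivity of the inner product enters. -/
theorem b_pow_succ_eq_zero (hv : σ.bstar n (σ.b n v) = (a : ℂ) • v) :
    σ.b n ((σ.b n ^ a) v) = 0 := by
  have h := number_b_pow hv a
  rw [sub_self, zero_smul] at h
  have h2 := σ.adjoint' n ((σ.b n ^ a) v) (σ.b n ((σ.b n ^ a) v))
  rw [h, Submodule.coe_zero, inner_zero_right, inner_self_eq_zero] at h2
  exact Subtype.ext h2

theorem bstar_pow_b_pow (hv : σ.bstar n (σ.b n v) = (a : ℂ) • v) (k : ℕ) :
    (σ.bstar n ^ k) ((σ.b n ^ k) v) = (a.descFactorial k : ℂ) • v := by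
  induction k with
  | zero => simp
  | succ k ih =>
    rw [pow_succ, pow_succ', Module.End.mul_apply, Module.End.mul_apply, number_b_pow hv, map_smul,
      ih, smul_smul, Nat.descFactorial_succ]
    rcases le_or_gt k a with h | h
    · push_cast [Nat.cast_sub h]; rfl
    · simp [Nat.descFactorial_eq_zero_iff_lt.2 h]

theorem b_bstar_pow {w : σ.D} (hw : σ.b n w = 0) (j : ℕ) :
    σ.b n ((σ.bstar n ^ j) w) = (j : ℂ) • (σ.bstar n ^ (j - 1)) w := by
  induction j with
  | zero => simpa using hw
  | succ j ih =>
    rw [pow_succ', Module.End.mul_apply, σ.b_bstar_apply, ih, if_pos rfl, map_smul]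
    rcases j with _ | j
    · simp
    · simp only [Nat.add_sub_cancel]
      rw [← Module.End.mul_apply, ← pow_succ']
      push_cast
      module

/-- The normalized ladder operator taking occupation number `a` to occupation number `j` in the
mode `n`. -/
noncomputable def ladderOp (σ : BosonRep H) (n a j : ℕ) : Module.End ℂ σ.D :=
  (((Real.sqrt j.factorial : ℂ))⁻¹ * ((Real.sqrt a.factorial : ℂ))⁻¹) •
    (σ.bstar n ^ j * σ.b n ^ a)

theorem sqrt_factorial_ne_zero (j : ℕ) : (Real.sqrt j.factorial : ℂ) ≠ 0 := by
  have : (0 : ℝ) < j.factorial := by exact_mod_cast j.factorial_pos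
  exact_mod_cast (Real.sqrt_pos.2 this).ne'

theorem sqrt_factorial_succ (j : ℕ) : (Real.sqrt (j + 1).factorial : ℂ)
    = (Real.sqrt ((j : ℝ) + 1) : ℂ) * (Real.sqrt j.factorial : ℂ) := by
  rw [Nat.factorial_succ, ← Complex.ofReal_mul, ← Real.sqrt_mul (by positivity)]
  push_cast; rfl

theorem sqrt_succ_ne_zero (j : ℕ) : (Real.sqrt ((j : ℝ) + 1) : ℂ) ≠ 0 := by
  have : (0 : ℝ) < (j : ℝ) + 1 := by positivity
  exact_mod_cast (Real.sqrt_pos.2 this).ne'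

/-- Lowering `a` times and raising `a` times multiplies by `a!`, which the normalization cancels. -/
theorem ladderOp_self (hv : σ.bstar n (σ.b n v) = (a : ℂ) • v) : σ.ladderOp n a a v = v := by
  rw [ladderOp, LinearMap.smul_apply, Module.End.mul_apply, bstar_pow_b_pow hv, smul_smul,
    Nat.descFactorial_self, ← mul_inv, ofReal_sqrt_mul_self (by positivity)]
  have : (a.factorial : ℂ) ≠ 0 := by exact_mod_cast a.factorial_ne_zero
  push_cast
  rw [inv_mul_cancel₀ this, one_smul]

theorem bstar_ladderOp (σ : BosonRep H) (n a j : ℕ) (v : σ.D) :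
    σ.bstar n (σ.ladderOp n a j v) = (Real.sqrt ((j : ℝ) + 1) : ℂ) • σ.ladderOp n a (j + 1) v := by
  rw [ladderOp, ladderOp, LinearMap.smul_apply, LinearMap.smul_apply, map_smul, smul_smul,
    Module.End.mul_apply, Module.End.mul_apply, pow_succ', Module.End.mul_apply,
    sqrt_factorial_succ]
  congr 1
  have h1 := sqrt_factorial_ne_zero j
  have h2 := sqrt_factorial_ne_zero a
  have h3 := sqrt_succ_ne_zero j
  field_simp

theorem b_ladderOp (hv : σ.bstar n (σ.b n v) = (a : ℂ) • v) (j : ℕ) :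
    σ.b n (σ.ladderOp n a j v) = (Real.sqrt (j : ℝ) : ℂ) • σ.ladderOp n a (j - 1) v := by
  rw [ladderOp, ladderOp, LinearMap.smul_apply, LinearMap.smul_apply, map_smul, smul_smul,
    Module.End.mul_apply, Module.End.mul_apply, b_bstar_pow (b_pow_succ_eq_zero hv), smul_smul]
  congr 1
  rcases j with _ | j
  · simp
  · rw [sqrt_factorial_succ, Nat.add_sub_cancel]
    have h1 := sqrt_factorial_ne_zero j
    have h2 := sqrt_factorial_ne_zero a
    have h3 := sqrt_succ_ne_zero j
    have h4 := ofReal_sqrt_mul_self (r := (j : ℝ) + 1) (by positivity)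
    push_cast at h4 ⊢
    field_simp
    rw [pow_two, h4]

end OneMode

theorem commute_b_b (σ : BosonRep H) (n m : ℕ) : Commute (σ.b n) (σ.b m) :=
  sub_eq_zero.1 (σ.comm_b n m)

theorem commute_bstar_bstar (σ : BosonRep H) (n m : ℕ) : Commute (σ.bstar n) (σ.bstar m) :=
  sub_eq_zero.1 (σ.comm_bstar n m)

theorem commute_b_bstar (σ : BosonRep H) {n m : ℕ} (h : n ≠ m) :
    Commute (σ.b n) (σ.bstar m) :=
  sub_eq_zero.1 ((σ.comm_b_bstar n m).trans (if_neg h))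

theorem commute_b_ladderOp (σ : BosonRep H) {n m : ℕ} (h : n ≠ m) (a j : ℕ) :
    Commute (σ.b n) (σ.ladderOp m a j) :=
  (((σ.commute_b_bstar h).pow_right j).mul_right ((σ.commute_b_b n m).pow_right a)).smul_right _

theorem commute_bstar_ladderOp (σ : BosonRep H) {n m : ℕ} (h : n ≠ m) (a j : ℕ) :
    Commute (σ.bstar n) (σ.ladderOp m a j) :=
  (((σ.commute_bstar_bstar n m).pow_right j).mul_right
    ((σ.commute_b_bstar h.symm).symm.pow_right a)).smul_right _

/-- The sequences that agree with `a` from some point on. -/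
def eventuallyEq (a : ℕ → ℕ) : Set (ℕ → ℕ) := {x | ∃ k, ∀ n, k ≤ n → x n = a n}

theorem update_mem_eventuallyEq {a x : ℕ → ℕ} (n j : ℕ) (hx : x ∈ eventuallyEq a) :
    Function.update x n j ∈ eventuallyEq a := by
  obtain ⟨k, hk⟩ := hx
  refine ⟨max k (n + 1), fun m hm => ?_⟩
  rw [Function.update_of_ne (by omega), hk m (by omega)]

theorem update_mem_eventuallyEq_iff {a : ℕ → ℕ} (x : ℕ → ℕ) (n j : ℕ) :
    Function.update x n j ∈ eventuallyEq a ↔ x ∈ eventuallyEq a :=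
  ⟨fun h => by simpa using update_mem_eventuallyEq n (x n) h, update_mem_eventuallyEq n j⟩

/-- Product of the ladder operators of the first `k` modes, from occupation `a` to `x`. -/
noncomputable def ladderProd (σ : BosonRep H) (a x : ℕ → ℕ) : ℕ → Module.End ℂ σ.D
  | 0 => 1
  | k + 1 => ladderProd σ a x k * σ.ladderOp k (a k) (x k)

section Ladder

variable {σ : BosonRep H} {a : ℕ → ℕ}

theorem ladderProd_congr {x y : ℕ → ℕ} {k : ℕ} (h : ∀ n < k, x n = y n) :
    σ.ladderProd a x k = σ.ladderProd a y k := by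
  induction k with
  | zero => rfl
  | succ k ih =>
    rw [ladderProd, ladderProd, ih fun n hn => h n (by omega), h k (by omega)]

theorem commute_b_ladderProd (σ : BosonRep H) (a x : ℕ → ℕ) {m k : ℕ} (h : k ≤ m) :
    Commute (σ.b m) (σ.ladderProd a x k) := by
  induction k with
  | zero => exact Commute.one_right _
  | succ k ih => exact (ih (by omega)).mul_right (σ.commute_b_ladderOp (by omega) _ _)

theorem commute_bstar_ladderProd (σ : BosonRep H) (a x : ℕ → ℕ) {m k : ℕ} (h : k ≤ m) :
    Commute (σ.bstar m) (σ.ladderProd a x k) := by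
  induction k with
  | zero => exact Commute.one_right _
  | succ k ih => exact (ih (by omega)).mul_right (σ.commute_bstar_ladderOp (by omega) _ _)

theorem number_ladderOp {m k : ℕ} (h : m ≠ k) {v : σ.D} {c : ℂ}
    (hv : σ.bstar m (σ.b m v) = c • v) (i j : ℕ) :
    σ.bstar m (σ.b m (σ.ladderOp k i j v)) = c • σ.ladderOp k i j v := by
  have h1 : ∀ w, σ.b m (σ.ladderOp k i j w) = σ.ladderOp k i j (σ.b m w) :=
    LinearMap.congr_fun (σ.commute_b_ladderOp h i j)
  have h2 : ∀ w, σ.bstar m (σ.ladderOp k i j w) = σ.ladderOp k i j (σ.bstar m w) :=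
    LinearMap.congr_fun (σ.commute_bstar_ladderOp h i j)
  rw [h1, h2, hv, map_smul]

theorem b_ladderProd (x : ℕ → ℕ) {m k : ℕ} (hm : m < k) {v : σ.D}
    (hv : ∀ n < k, σ.bstar n (σ.b n v) = (a n : ℂ) • v) :
    σ.b m (σ.ladderProd a x k v) = (Real.sqrt (x m) : ℂ) •
      σ.ladderProd a (Function.update x m (x m - 1)) k v := by
  induction k generalizing v with
  | zero => omega
  | succ k ih =>
    rw [ladderProd, ladderProd, Module.End.mul_apply, Module.End.mul_apply]
    rcases Nat.lt_succ_iff_lt_or_eq.1 hm with h | rfl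
    · rw [Function.update_of_ne h.ne']
      -- The factor of mode `k` acts on `v` first and keeps the eigenvalues of the other modes;
      -- hence the induction is over all `v`.
      exact ih h fun n hn => number_ladderOp (by omega) (hv n (by omega)) _ _
    · rw [← Module.End.mul_apply, (σ.commute_b_ladderProd a x le_rfl).eq, Module.End.mul_apply,
        b_ladderOp (hv _ (by omega)), map_smul, Function.update_self]
      congr 2
      exact ladderProd_congr fun n hn => by rw [Function.update_of_ne hn.ne]

theorem bstar_ladderProd (x : ℕ → ℕ) {m k : ℕ} (hm : m < k) (v : σ.D) :
    σ.bstar m (σ.ladderProd a x k v) = (Real.sqrt ((x m : ℝ) + 1) : ℂ) •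
      σ.ladderProd a (Function.update x m (x m + 1)) k v := by
  induction k generalizing v with
  | zero => omega
  | succ k ih =>
    rw [ladderProd, ladderProd, Module.End.mul_apply, Module.End.mul_apply]
    rcases Nat.lt_succ_iff_lt_or_eq.1 hm with h | rfl
    · rw [Function.update_of_ne h.ne']
      exact ih h _
    · rw [← Module.End.mul_apply, (σ.commute_bstar_ladderProd a x le_rfl).eq, Module.End.mul_apply,
        bstar_ladderOp, map_smul, Function.update_self]
      congr 2
      exact ladderProd_congr fun n hn => by rw [Function.update_of_ne hn.ne]

/-- Modes in which `x` agrees with `a` contribute trivially, so the formally infinite product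
stabilizes and does not depend on the cutoff. -/
theorem ladderProd_eq_of_le {Ω : σ.D} (hΩ : ∀ n, σ.bstar n (σ.b n Ω) = (a n : ℂ) • Ω)
    {x : ℕ → ℕ} {k l : ℕ} (hkl : k ≤ l) (h : ∀ n, k ≤ n → x n = a n) :
    σ.ladderProd a x l Ω = σ.ladderProd a x k Ω := by
  induction l, hkl using Nat.le_induction with
  | base => rfl
  | succ l hl ih => rw [ladderProd, Module.End.mul_apply, h l hl, ladderOp_self (hΩ l), ih]

/-- A representation generated by a vector with occupation numbers `a` has an occupation number
basis indexed by the sequences that eventually agree with `a`. -/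
theorem hasFock_of_cyclic {Ω : σ.D} (h0 : Ω ≠ 0) (hcyc : σ.IsCyclicVector Ω)
    (hΩ : ∀ n, σ.bstar n (σ.b n Ω) = (a n : ℂ) • Ω) : σ.HasFock (eventuallyEq a) := by
  classical
  have hnorm : ‖(Ω : H)‖ ≠ 0 := by simpa using h0
  let Ψ : σ.D := ((‖(Ω : H)‖ : ℂ)⁻¹) • Ω
  have hΨ : ∀ n, σ.bstar n (σ.b n Ψ) = (a n : ℂ) • Ψ := fun n => by
    rw [map_smul, map_smul, hΩ, smul_comm]
  have hΨn : ‖(Ψ : H)‖ = 1 := by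
    simp only [Ψ, Submodule.coe_smul, norm_smul, norm_inv, Complex.norm_real, norm_norm]
    exact inv_mul_cancel₀ hnorm
  let e : (ℕ → ℕ) → σ.D := fun x =>
    if h : x ∈ eventuallyEq a then σ.ladderProd a x h.choose Ψ else 0
  have he : ∀ (x : ℕ → ℕ) (k : ℕ), (∀ n, k ≤ n → x n = a n) → e x = σ.ladderProd a x k Ψ := by
    intro x k hk
    have hx : x ∈ eventuallyEq a := ⟨k, hk⟩
    simp only [e, dif_pos hx]
    rcases le_total k hx.choose with h | h
    · exact ladderProd_eq_of_le hΨ h hk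
    · exact (ladderProd_eq_of_le hΨ h hx.choose_spec).symm
  have he0 : ∀ x ∉ eventuallyEq a, e x = 0 := fun x hx => dif_neg hx
  have hupd : ∀ {x : ℕ → ℕ} {k n : ℕ} (j : ℕ), (∀ n, k ≤ n → x n = a n) →
      ∀ m, max k (n + 1) ≤ m → Function.update x n j m = a m := fun j hk m hm => by
    rw [Function.update_of_ne (by omega), hk m (by omega)]
  have hb : ∀ n x, σ.b n (e x) = (Real.sqrt (x n) : ℂ) • e (Function.update x n (x n - 1)) := by
    intro n x
    by_cases hx : x ∈ eventuallyEq a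
    · obtain ⟨k, hk⟩ := hx
      rw [he x (max k (n + 1)) fun m hm => hk m (by omega), he _ _ (hupd _ hk),
        b_ladderProd x (by omega) fun m _ => hΨ m]
    · rw [he0 x hx, he0 _ (by rwa [update_mem_eventuallyEq_iff]), map_zero, smul_zero]
  have hbs : ∀ n x,
      σ.bstar n (e x) = (Real.sqrt (x n + 1) : ℂ) • e (Function.update x n (x n + 1)) := by
    intro n x
    by_cases hx : x ∈ eventuallyEq a
    · obtain ⟨k, hk⟩ := hx
      rw [he x (max k (n + 1)) fun m hm => hk m (by omega), he _ _ (hupd _ hk),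
        bstar_ladderProd x (by omega)]
    · rw [he0 x hx, he0 _ (by rwa [update_mem_eventuallyEq_iff]), map_zero, smul_zero]
  have hea : e a = Ψ := he a 0 fun _ _ => rfl
  have hΩe : Ω = (‖(Ω : H)‖ : ℂ) • e a := by
    rw [hea, smul_smul, mul_inv_cancel₀ (by exact_mod_cast hnorm), one_smul]
  have hspan : Submodule.span ℂ (Set.range e) = ⊤ := by
    rw [eq_top_iff]
    rintro v -
    obtain ⟨T, hT, rfl⟩ := hcyc v
    -- The span is invariant under every generator, hence under the whole algebra; it contains `Ω`,
    -- so cyclicity makes it everything.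
    have key : ∀ w ∈ Submodule.span ℂ (Set.range e), T w ∈ Submodule.span ℂ (Set.range e) := by
      induction hT using Algebra.adjoin_induction with
      | mem T hT =>
        intro w hw
        have : Submodule.span ℂ (Set.range e) ≤ (Submodule.span ℂ (Set.range e)).comap T := by
          rw [Submodule.span_le]
          rintro _ ⟨x, rfl⟩
          rw [SetLike.mem_coe, Submodule.mem_comap]
          rcases hT with ⟨n, rfl⟩ | ⟨n, rfl⟩
          · rw [hb]
            exact Submodule.smul_mem _ _ (Submodule.subset_span ⟨_, rfl⟩)
          · rw [hbs]
            exact Submodule.smul_mem _ _ (Submodule.subset_span ⟨_, rfl⟩)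
        exact this hw
      | algebraMap c => exact fun w hw => Submodule.smul_mem _ c hw
      | add S T _ _ hS hT => exact fun w hw => Submodule.add_mem _ (hS w hw) (hT w hw)
      | mul S T _ _ hS hT => exact fun w hw => hS _ (hT w hw)
    apply key
    rw [hΩe]
    exact Submodule.smul_mem _ _ (Submodule.subset_span ⟨_, rfl⟩)
  have hl : σ.HasLadder e := ⟨hspan, hb, hbs⟩
  refine ⟨e, hl, he0, ?_⟩
  rintro x ⟨k, hk⟩
  induction k generalizing x with
  | zero => rw [show x = a from funext fun n => hk n (Nat.zero_le n), hea, hΨn]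
  | succ k ih =>
    -- Resetting entry `k` to `a k` preserves the norm and lets the agreement with `a` start one
    -- place earlier.
    rw [← hl.norm_update k (a k) x]
    apply ih
    intro n hn
    rcases eq_or_lt_of_le hn with rfl | hn
    · simp
    · rw [Function.update_of_ne (by omega), hk n hn]

/-- Changing one entry never leaves the cyclic submodule, because the ladder coefficients involved
are nonzero, and each index differs from `a` in finitely many entries. -/
theorem IsFockFamily.isCyclicVector {e : (ℕ → ℕ) → σ.D}
    (h : σ.IsFockFamily (eventuallyEq a) e) : σ.IsCyclicVector (e a) := by
  classical
  let M : Submodule ℂ σ.D := (Subalgebra.toSubmodule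
    (Algebra.adjoin ℂ (Set.range σ.b ∪ Set.range σ.bstar))).map (LinearMap.applyₗ (e a))
  have hMb : ∀ n, ∀ v ∈ M, σ.b n v ∈ M := by
    rintro n _ ⟨T, hT, rfl⟩
    exact ⟨σ.b n * T, Subalgebra.mul_mem _ (Algebra.subset_adjoin (Or.inl ⟨n, rfl⟩)) hT, rfl⟩
  have hMbs : ∀ n, ∀ v ∈ M, σ.bstar n v ∈ M := by
    rintro n _ ⟨T, hT, rfl⟩
    exact ⟨σ.bstar n * T, Subalgebra.mul_mem _ (Algebra.subset_adjoin (Or.inr ⟨n, rfl⟩)) hT, rfl⟩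
  have hsucc : ∀ n j x, e (Function.update x n j) ∈ M ↔ e (Function.update x n (j + 1)) ∈ M := by
    intro n j x
    constructor
    · intro hx
      have h1 := hMbs n _ hx
      rw [h.bstar_apply, Function.update_self, Function.update_idem] at h1
      exact (M.smul_mem_iff (sqrt_succ_ne_zero j)).1 h1
    · intro hx
      have h1 := hMb n _ hx
      rw [h.b_apply, Function.update_self, Function.update_idem, Nat.add_sub_cancel] at h1
      push_cast at h1
      exact (M.smul_mem_iff (sqrt_succ_ne_zero j)).1 h1
  have hzero : ∀ n j x, e (Function.update x n j) ∈ M ↔ e (Function.update x n 0) ∈ M := by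
    intro n j x
    induction j with
    | zero => rfl
    | succ j ih => rw [← hsucc, ih]
  have hM : ∀ x, e x ∈ M := by
    intro x
    by_cases hx : x ∈ eventuallyEq a
    · obtain ⟨k, hk⟩ := hx
      induction k generalizing x with
      | zero =>
        rw [show x = a from funext fun n => hk n (Nat.zero_le n)]
        exact ⟨1, Subalgebra.one_mem _, rfl⟩
      | succ k ih =>
        have h1 : e (Function.update x k (a k)) ∈ M := by
          apply ih
          intro n hn
          rcases eq_or_lt_of_le hn with rfl | hn
          · simp
          · rw [Function.update_of_ne (by omega), hk n hn]
        rw [hzero, ← hzero k (x k), Function.update_eq_self] at h1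
        exact h1
    · rw [h.zero x hx]
      exact zero_mem _
  intro v
  have hv : v ∈ Submodule.span ℂ (Set.range e) := by rw [h.span]; trivial
  obtain ⟨T, hT, hTv⟩ := Submodule.span_le.2 (by rintro _ ⟨x, rfl⟩; exact hM x) hv
  exact ⟨T, hT, hTv⟩

end Ladder

/-! ### The boson classes in terms of occupation number bases -/

/-- The occupation numbers of the cyclic vector of `BF_{q,i}(c + 1)`. -/
def periodicOcc (q i c : ℕ) (n : ℕ) : ℕ := if n % q = i then c else 0

/-- Since $bb^*=b^*b+1$, the eigenvalue `c + 1` of $bb^*$ means occupation number `c`. -/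
theorem isBF_iff_hasFock {q : ℕ} (i : Fin q) (c : ℕ) (σ : BosonRep H) :
    σ.IsBF q i ((c + 1 : ℕ) : ℝ) ↔ σ.HasFock (eventuallyEq (periodicOcc q i c)) := by
  constructor
  · rintro ⟨Ω, h0, hcyc, h1, h2⟩
    refine hasFock_of_cyclic h0 hcyc fun n => ?_
    rw [periodicOcc]
    split_ifs with h
    · have h3 := h1 (n / q)
      rw [← h, Nat.div_add_mod, b_bstar_apply, if_pos rfl] at h3
      rw [eq_sub_of_add_eq h3]
      push_cast
      module
    · have h3 := h2 (n / q) ⟨n % q, Nat.mod_lt _ i.pos⟩ fun hc => h (congrArg Fin.val hc)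
      rw [Nat.div_add_mod] at h3
      rw [h3, map_zero, Nat.cast_zero, zero_smul]
  · rintro ⟨e, he⟩
    refine ⟨e (periodicOcc q i c), fun hc => ?_, he.isCyclicVector, fun n => ?_, fun n j hj => ?_⟩
    · have := he.norm (periodicOcc q i c) ⟨0, fun _ _ => rfl⟩
      rw [hc] at this
      simp at this
    · rw [he.toHasLadder.b_bstar, periodicOcc, Nat.mul_add_mod, Nat.mod_eq_of_lt i.2, if_pos rfl]
      push_cast; rfl
    · rw [he.b_apply, periodicOcc, Nat.mul_add_mod, Nat.mod_eq_of_lt j.2,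
        if_neg fun hc => hj (Fin.ext hc)]
      simp

theorem disjoint_eventuallyEq_periodicOcc {q c : ℕ} (hc : c ≠ 0) :
    Pairwise fun i j : Fin q => Disjoint (eventuallyEq (periodicOcc q i c))
      (eventuallyEq (periodicOcc q j c)) := by
  intro i j hij
  rw [Set.disjoint_left]
  rintro x ⟨k, hk⟩ ⟨l, hl⟩
  have hi := i.pos
  -- A position beyond both thresholds and congruent to `i`: a common member would have there both
  -- the value `c` and the value `0`.
  have hm : (q * (k + l) + i) % q = i := by rw [Nat.mul_add_mod, Nat.mod_eq_of_lt i.2]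
  have hle : k + l ≤ q * (k + l) := Nat.le_mul_of_pos_left _ hi
  have h1 := hk (q * (k + l) + i) (by omega)
  have h2 := hl (q * (k + l) + i) (by omega)
  rw [h1, periodicOcc, periodicOcc, hm, if_pos rfl, if_neg fun h => hij (Fin.ext h)] at h2
  exact hc h2

theorem isSumBF_iff_hasFock {q c : ℕ} (hc : c ≠ 0) (σ : BosonRep H) :
    σ.IsSumBF q ((c + 1 : ℕ) : ℝ) ↔
      σ.HasFock (⋃ i : Fin q, eventuallyEq (periodicOcc q i c)) := by
  constructor
  · rintro ⟨L, _, _, _, τ, hτ, h⟩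
    exact (HasFock.directSum (disjoint_eventuallyEq_periodicOcc hc)
      fun i => (isBF_iff_hasFock i c _).1 (hτ i)).of_unitaryEquiv h
  · intro h
    choose τ hτ using fun i : Fin q => exists_hasFock.{u}
      (X := eventuallyEq (periodicOcc q i c)) update_mem_eventuallyEq_iff
    exact ⟨_, inferInstance, inferInstance, inferInstance, τ,
      fun i => (isBF_iff_hasFock i c _).2 (hτ i),
      h.unitaryEquiv (HasFock.directSum (disjoint_eventuallyEq_periodicOcc hc) hτ)⟩

end BosonRep

/-! ### Words in isometries and the sequence basis -/

section Words

variable {H : Type u} [NormedAddCommGroup H] [InnerProductSpace ℂ H]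
variable {ι : Type}

theorem wordOp_nil_apply (s : ι → (H →L[ℂ] H)) (v : H) : wordOp s [] v = v := rfl

theorem wordOp_cons_apply (s : ι → (H →L[ℂ] H)) (i : ι) (I : List ι) (v : H) :
    wordOp s (i :: I) v = s i (wordOp s I v) := by
  simp [wordOp]

theorem wordOp_append_apply (s : ι → (H →L[ℂ] H)) (I I' : List ι) (v : H) :
    wordOp s (I ++ I') v = wordOp s I (wordOp s I' v) := by
  simp [wordOp]

theorem wordOp_replicate_apply (s : ι → (H →L[ℂ] H)) (k : ℕ) (i : ι) (v : H) :
    wordOp s (List.replicate k i) v = (s i ^ k) v := by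
  simp [wordOp]

theorem wordOp_apply_mem_orbitSpan (s : ι → (H →L[ℂ] H)) (Ω : H) (I : List ι) :
    wordOp s I Ω ∈ orbitSpan s Ω :=
  Submodule.subset_span ⟨I, rfl⟩

theorem apply_mem_orbitSpan (s : ι → (H →L[ℂ] H)) (Ω : H) (i : ι) {v : H}
    (hv : v ∈ orbitSpan s Ω) : s i v ∈ orbitSpan s Ω := by
  have : orbitSpan s Ω ≤ (orbitSpan s Ω).comap (s i : H →ₗ[ℂ] H) := by
    refine Submodule.span_le.2 ?_
    rintro _ ⟨I, rfl⟩
    exact Submodule.subset_span ⟨i :: I, wordOp_cons_apply _ _ _ _⟩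
  exact this hv

section Isometries

variable [CompleteSpace H] [DecidableEq ι] {s : ι → (H →L[ℂ] H)}

theorem star_apply_apply (hs : ∀ i j, star (s i) * s j = if i = j then 1 else 0) (i j : ι) (v : H) :
    star (s i) (s j v) = if i = j then v else 0 := by
  have h := DFunLike.congr_fun (hs i j) v
  change star (s i) (s j v) = _ at h
  rw [h]
  split_ifs <;> rfl

theorem inner_apply_apply (hs : ∀ i j, star (s i) * s j = if i = j then 1 else 0) (i j : ι)
    (v w : H) : ⟪s i v, s j w⟫_ℂ = if i = j then ⟪v, w⟫_ℂ else 0 := by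
  rw [← ContinuousLinearMap.adjoint_inner_right, ← ContinuousLinearMap.star_eq_adjoint,
    star_apply_apply hs]
  split_ifs <;> simp

theorem norm_apply_eq (hs : ∀ i j, star (s i) * s j = if i = j then 1 else 0) (i : ι) (v : H) :
    ‖s i v‖ = ‖v‖ := by
  have h := inner_apply_apply hs i i v v
  rw [if_pos rfl, inner_self_eq_norm_sq_to_K, inner_self_eq_norm_sq_to_K] at h
  exact (sq_eq_sq₀ (norm_nonneg _) (norm_nonneg _)).1 (by exact_mod_cast h)

theorem norm_wordOp_apply (hs : ∀ i j, star (s i) * s j = if i = j then 1 else 0) (I : List ι)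
    (v : H) : ‖wordOp s I v‖ = ‖v‖ := by
  induction I with
  | nil => rfl
  | cons i I ih => rw [wordOp_cons_apply, norm_apply_eq hs, ih]

theorem star_apply_mem_orbitSpan (hs : ∀ i j, star (s i) * s j = if i = j then 1 else 0)
    {J : List ι} (hJ : J ≠ []) {Ω : H} (hfix : wordOp s J Ω = Ω) (i : ι) {v : H}
    (hv : v ∈ orbitSpan s Ω) : star (s i) v ∈ orbitSpan s Ω := by
  have hcons : ∀ j I, star (s i) (wordOp s (j :: I) Ω) ∈ orbitSpan s Ω := fun j I => by
    rw [wordOp_cons_apply, star_apply_apply hs]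
    split_ifs
    · exact wordOp_apply_mem_orbitSpan s Ω I
    · exact zero_mem _
  have : orbitSpan s Ω ≤ (orbitSpan s Ω).comap ((star (s i) : H →L[ℂ] H) : H →ₗ[ℂ] H) := by
    refine Submodule.span_le.2 ?_
    rintro _ ⟨I, rfl⟩
    rcases I with _ | ⟨j, I⟩
    -- For the empty word, `Ω` is first rewritten as $s_J\Omega$, which has a letter to strip.
    · obtain ⟨j, I, rfl⟩ := List.exists_cons_of_ne_nil hJ
      have h := hcons j I
      rw [hfix] at h
      exact h
    · exact hcons j I
  exact this hv

theorem IsGPVector.dense_orbitSpan {J : List ι} {Ω : H} (h : IsGPVector s J Ω) (hJ : J ≠ [])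
    (hs : ∀ i j, star (s i) * s j = if i = j then 1 else 0) :
    Dense (orbitSpan s Ω : Set H) := by
  refine h.cyclic.mono ?_
  rintro _ ⟨T, hT, rfl⟩
  -- Carrying `T` and `star T` together makes the induction close under the star.
  have key : ∀ v ∈ orbitSpan s Ω, T v ∈ orbitSpan s Ω ∧ star T v ∈ orbitSpan s Ω := by
    induction hT using StarAlgebra.adjoin_induction with
    | mem T hT =>
      obtain ⟨i, rfl⟩ := hT
      exact fun v hv => ⟨apply_mem_orbitSpan s Ω i hv, star_apply_mem_orbitSpan hs hJ h.fixed i hv⟩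
    | algebraMap c =>
      intro v hv
      rw [Algebra.algebraMap_eq_smul_one, star_smul, star_one]
      exact ⟨Submodule.smul_mem _ c hv, Submodule.smul_mem _ _ hv⟩
    | add S T _ _ hS hT =>
      intro v hv
      rw [star_add]
      exact ⟨Submodule.add_mem _ (hS v hv).1 (hT v hv).1,
        Submodule.add_mem _ (hS v hv).2 (hT v hv).2⟩
    | mul S T _ _ hS hT =>
      intro v hv
      rw [star_mul]
      exact ⟨(hS _ (hT v hv).1).1, (hT _ (hS v hv).2).2⟩
    | star T _ hT =>
      intro v hv
      rw [star_star]
      exact (hT v hv).symm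
  exact (key Ω (Submodule.subset_span ⟨[], rfl⟩)).1

end Isometries

/-- The periodic sequence `JJJ⋯`. -/
def periodicSeq (J : List ι) (hJ : J ≠ []) (n : ℕ) : ι :=
  J[n % J.length]'(Nat.mod_lt _ (List.length_pos_iff.2 hJ))

/-- The sequences that have a tail in common with `c`. -/
def tailClass (c : ℕ → ι) : Set (ℕ → ι) := {x | ∃ k l, ∀ n, x (n + k) = c (n + l)}

/-- The sequence `i, x 0, x 1, …`. -/
def seqCons (i : ι) (x : ℕ → ι) : ℕ → ι
  | 0 => i
  | n + 1 => x n

theorem tail_mem_tailClass_iff {c x : ℕ → ι} :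
    (fun n => x (n + 1)) ∈ tailClass c ↔ x ∈ tailClass c := by
  constructor
  · rintro ⟨k, l, h⟩
    exact ⟨k + 1, l, h⟩
  · rintro ⟨k, l, h⟩
    refine ⟨k, l + 1, fun n => ?_⟩
    have := h (n + 1)
    change x (n + k + 1) = c (n + (l + 1))
    rw [show n + k + 1 = n + 1 + k by ring, this, show n + 1 + l = n + (l + 1) by ring]

theorem seqCons_mem_tailClass_iff {c x : ℕ → ι} (i : ι) :
    seqCons i x ∈ tailClass c ↔ x ∈ tailClass c :=
  tail_mem_tailClass_iff.symm

theorem update_mem_tailClass {c x : ℕ → ι} (n : ℕ) (j : ι) (hx : x ∈ tailClass c) :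
    Function.update x n j ∈ tailClass c := by
  obtain ⟨k, l, h⟩ := hx
  refine ⟨k + (n + 1), l + (n + 1), fun m => ?_⟩
  have := h (m + (n + 1))
  rw [Function.update_of_ne (by omega), show m + (k + (n + 1)) = m + (n + 1) + k by ring, this,
    show m + (n + 1) + l = m + (l + (n + 1)) by ring]

theorem update_mem_tailClass_iff {c : ℕ → ι} (x : ℕ → ι) (n : ℕ) (j : ι) :
    Function.update x n j ∈ tailClass c ↔ x ∈ tailClass c :=
  ⟨fun h => by simpa using update_mem_tailClass n (x n) h, update_mem_tailClass n j⟩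

section Periodic

variable {J : List ι} {hJ : J ≠ []}

theorem periodicSeq_add_of_dvd {l : ℕ} (h : J.length ∣ l) (n : ℕ) :
    periodicSeq J hJ (n + l) = periodicSeq J hJ n := by
  obtain ⟨d, rfl⟩ := h
  simp [periodicSeq]

theorem exists_add_dvd (hJ : J ≠ []) (l : ℕ) : ∃ d, J.length ∣ l + d := by
  have h := List.length_pos_iff.2 hJ
  exact ⟨J.length * l - l, l, Nat.add_sub_cancel' (Nat.le_mul_of_pos_left _ h)⟩

theorem drop_eq_map_periodicSeq {l : ℕ} (hl : l ≤ J.length) :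
    J.drop l = (List.range (J.length - l)).map fun n => periodicSeq J hJ (n + l) := by
  apply List.ext_getElem
  · simp
  · intro n h1 h2
    simp only [List.length_drop] at h1
    simp only [List.getElem_drop, List.getElem_map, List.getElem_range, periodicSeq]
    congr 1
    rw [Nat.mod_eq_of_lt (by omega), add_comm]

/-- A letter that occurs exactly once per period marks the phase, so equal shifts of the periodic
sequence have equal phase. This is how aperiodicity is checked. -/
theorem mod_eq_of_letter {α : ι} {r : ℕ} (hr : r < J.length)
    (h : ∀ n, periodicSeq J hJ n = α ↔ n % J.length = r) {l l' : ℕ}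
    (hl : ∀ n, periodicSeq J hJ (n + l) = periodicSeq J hJ (n + l')) :
    l % J.length = l' % J.length := by
  obtain ⟨d, hd⟩ := exists_add_dvd hJ l
  have h1 : (r + d + l) % J.length = r := by
    rw [add_assoc, add_comm d l, Nat.add_mod, Nat.mod_eq_zero_of_dvd hd, add_zero, Nat.mod_mod,
      Nat.mod_eq_of_lt hr]
  have h2 : (r + d + l') % J.length = r := by rw [← h, ← hl, h, h1]
  exact Nat.ModEq.add_left_cancel' (r + d) (h1.trans h2.symm)

end Periodic

theorem apply_eq_wordOp_apply {s : ι → (H →L[ℂ] H)} {e : (ℕ → ι) → H}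
    (he : ∀ x, e x = s (x 0) (e fun n => x (n + 1))) (x : ℕ → ι) (k : ℕ) :
    e x = wordOp s ((List.range k).map x) (e fun n => x (n + k)) := by
  induction k with
  | zero => rfl
  | succ k ih =>
    rw [List.range_succ, List.map_append, wordOp_append_apply, ih]
    congr 1
    rw [he]
    simp only [List.map_cons, List.map_nil, wordOp_cons_apply, wordOp_nil_apply]
    rw [zero_add]
    simp only [add_comm k 1, add_assoc]

theorem exists_eq_wordOp_apply {s : ι → (H →L[ℂ] H)} {e : (ℕ → ι) → H} {J : List ι} (hJ : J ≠ [])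
    (he : ∀ x, e x = s (x 0) (e fun n => x (n + 1))) {x : ℕ → ι}
    (hx : x ∈ tailClass (periodicSeq J hJ)) :
    ∃ I, e x = wordOp s I (e (periodicSeq J hJ)) := by
  obtain ⟨k, l, h⟩ := hx
  -- Lengthening the prefix by `d` letters moves the remaining tail to the start of a period.
  obtain ⟨d, hd⟩ := exists_add_dvd hJ l
  refine ⟨(List.range (k + d)).map x, ?_⟩
  rw [apply_eq_wordOp_apply he x (k + d)]
  congr 2
  ext n
  rw [← periodicSeq_add_of_dvd hd, show n + (k + d) = n + d + k by ring, h]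
  congr 1; ring

theorem exists_wordOp_apply_eq {s : ι → (H →L[ℂ] H)} {e : (ℕ → ι) → H} {c : ℕ → ι}
    (he : ∀ x, e x = s (x 0) (e fun n => x (n + 1))) (I : List ι) :
    ∃ x ∈ tailClass c, wordOp s I (e c) = e x := by
  induction I with
  | nil => exact ⟨c, ⟨0, 0, fun _ => rfl⟩, rfl⟩
  | cons i I ih =>
    obtain ⟨x, hx, h⟩ := ih
    refine ⟨seqCons i x, (seqCons_mem_tailClass_iff i).2 hx, ?_⟩
    rw [wordOp_cons_apply, h, he (seqCons i x)]
    rfl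

theorem span_range_eq_orbitSpan {s : ι → (H →L[ℂ] H)} {e : (ℕ → ι) → H} {J : List ι} (hJ : J ≠ [])
    (he : ∀ x, e x = s (x 0) (e fun n => x (n + 1)))
    (hzero : ∀ x ∉ tailClass (periodicSeq J hJ), e x = 0) :
    Submodule.span ℂ (Set.range e) = orbitSpan s (e (periodicSeq J hJ)) := by
  apply le_antisymm <;> rw [orbitSpan, Submodule.span_le]
  · rintro _ ⟨x, rfl⟩
    by_cases hx : x ∈ tailClass (periodicSeq J hJ)
    · obtain ⟨I, hI⟩ := exists_eq_wordOp_apply hJ he hx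
      rw [hI]
      exact Submodule.subset_span ⟨I, rfl⟩
    · rw [hzero x hx]
      exact zero_mem _
  · rintro _ ⟨I, rfl⟩
    obtain ⟨x, -, hx⟩ := exists_wordOp_apply_eq he I
    exact Submodule.subset_span ⟨x, hx.symm⟩

theorem wordOp_drop_eq {s : ι → (H →L[ℂ] H)} {J : List ι} (hJ : J ≠ []) {Ω : H}
    (hfix : wordOp s J Ω = Ω) (l : ℕ) :
    wordOp s (J.drop (l % J.length)) Ω = s (periodicSeq J hJ l)
      (wordOp s (J.drop ((l + 1) % J.length)) Ω) := by
  have hlt := Nat.mod_lt l (List.length_pos_iff.2 hJ)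
  rw [List.drop_eq_getElem_cons hlt, wordOp_cons_apply]
  congr 1
  rcases Nat.lt_or_ge (l % J.length + 1) J.length with h | h
  · rw [← Nat.mod_add_mod l, Nat.mod_eq_of_lt h]
  · have h1 : l % J.length + 1 = J.length := by omega
    rw [← Nat.mod_add_mod l, h1, Nat.mod_self, List.drop_length, List.drop_zero, hfix]
    rfl

theorem inner_eq_zero_of_ne [CompleteSpace H] [DecidableEq ι] {s : ι → (H →L[ℂ] H)} {e : (ℕ → ι) → H}
    (hs : ∀ i j, star (s i) * s j = if i = j then 1 else 0)
    (he : ∀ x, e x = s (x 0) (e fun n => x (n + 1))) {x y : ℕ → ι} (hxy : x ≠ y) :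
    ⟪e x, e y⟫_ℂ = 0 := by
  obtain ⟨n, hn⟩ := Function.ne_iff.1 hxy
  clear hxy
  induction n generalizing x y with
  | zero => rw [he x, he y, inner_apply_apply hs, if_neg hn]
  | succ n ih =>
    rw [he x, he y, inner_apply_apply hs]
    split_ifs
    · exact ih hn
    · rfl

/-- A representation of the Cuntz relations with a vector fixed by an aperiodic word is, on the
orbit of that vector, the permutative representation on sequences. -/
theorem exists_seq_basis [CompleteSpace H] [DecidableEq ι] {s : ι → (H →L[ℂ] H)}
    (hs : ∀ i j, star (s i) * s j = if i = j then 1 else 0) {J : List ι} (hJ : J ≠ []) {Ω : H}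
    (hfix : wordOp s J Ω = Ω)
    (hap : ∀ l l', (∀ n, periodicSeq J hJ (n + l) = periodicSeq J hJ (n + l')) →
      l % J.length = l' % J.length) :
    ∃ e : (ℕ → ι) → H, (∀ x ∉ tailClass (periodicSeq J hJ), e x = 0) ∧
      (∀ x ∈ tailClass (periodicSeq J hJ), ‖e x‖ = ‖Ω‖) ∧
      (∀ x, e x = s (x 0) (e fun n => x (n + 1))) ∧ e (periodicSeq J hJ) = Ω := by
  classical
  let c := periodicSeq J hJ
  -- `ζ l` plays the role of the basis vector of the tail of `c` from `l` on; a general $e_x$ is a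
  -- prefix of `x` applied to some `ζ l`.
  let ζ : ℕ → H := fun l => wordOp s (J.drop (l % J.length)) Ω
  have hζ : ∀ l, ζ l = s (c l) (ζ (l + 1)) := wordOp_drop_eq hJ hfix
  have step : ∀ (x : ℕ → ι) (k l d : ℕ), (∀ n, x (n + k) = c (n + l)) →
      wordOp s ((List.range k).map x) (ζ l) = wordOp s ((List.range (k + d)).map x) (ζ (l + d)) := by
    intro x k l d h
    induction d with
    | zero => rfl
    | succ d ih =>
      rw [ih, hζ, ← add_assoc, List.range_succ, List.map_append, wordOp_append_apply,
        show c (l + d) = x (k + d) by rw [add_comm l, add_comm k, h]]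
      rfl
  -- The vector does not depend on the chosen decomposition: `step` equalizes the prefix lengths,
  -- and aperiodicity then equalizes the phases of the tails.
  have huniq : ∀ (x : ℕ → ι) (k l k' l' : ℕ), k ≤ k' → (∀ n, x (n + k) = c (n + l)) →
      (∀ n, x (n + k') = c (n + l')) →
      wordOp s ((List.range k).map x) (ζ l) = wordOp s ((List.range k').map x) (ζ l') := by
    intro x k l k' l' hk h h'
    obtain ⟨d, rfl⟩ := Nat.exists_eq_add_of_le hk
    rw [step x k l d h]
    have h2 : (l + d) % J.length = l' % J.length := hap _ _ fun n => by
      change c _ = c _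
      rw [← h' n, show n + (k + d) = n + d + k by ring, h]
      congr 1; ring
    simp only [ζ, h2]
  let e : (ℕ → ι) → H := fun x => if h : x ∈ tailClass c then
    wordOp s ((List.range h.choose).map x) (ζ h.choose_spec.choose) else 0
  have he : ∀ (x : ℕ → ι) (k l : ℕ), (∀ n, x (n + k) = c (n + l)) →
      e x = wordOp s ((List.range k).map x) (ζ l) := by
    intro x k l h
    have hx : x ∈ tailClass c := ⟨k, l, h⟩
    simp only [e, dif_pos hx]
    rcases le_total k hx.choose with hk | hk
    · exact (huniq x _ _ _ _ hk h hx.choose_spec.choose_spec).symm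
    · exact huniq x _ _ _ _ hk hx.choose_spec.choose_spec h
  have hzero : ∀ x ∉ tailClass c, e x = 0 := fun x hx => dif_neg hx
  refine ⟨e, hzero, ?_, ?_, ?_⟩
  · rintro x ⟨k, l, h⟩
    rw [he x k l h, norm_wordOp_apply hs, norm_wordOp_apply hs]
  · intro x
    by_cases hx : x ∈ tailClass c
    · obtain ⟨k, l, h⟩ := tail_mem_tailClass_iff.2 hx
      have h' : ∀ n, x (n + (k + 1)) = c (n + l) := h
      rw [he (fun n => x (n + 1)) k l h, he x (k + 1) l h', List.range_succ_eq_map, List.map_cons, wordOp_cons_apply,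
        List.map_map]
      rfl
    · rw [hzero x hx, hzero _ (by rwa [tail_mem_tailClass_iff]), map_zero]
  · rw [he c 0 0 fun _ => rfl]
    simp [ζ, wordOp_nil_apply, hfix]

end Words

/-! ### The recursive boson system on the sequence basis -/

theorem hasSum_apply_of_span_eq_top {α β M H : Type*} [AddCommGroup M] [Module ℂ M]
    [NormedAddCommGroup H] [InnerProductSpace ℂ H] {T : α → M →ₗ[ℂ] H} {T' : M →ₗ[ℂ] H} {f : β → M}
    (hf : Submodule.span ℂ (Set.range f) = ⊤)
    (h : ∀ i, HasSum (fun m => T m (f i)) (T' (f i))) (v : M) : HasSum (fun m => T m v) (T' v) := by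
  have hv : v ∈ Submodule.span ℂ (Set.range f) := by rw [hf]; trivial
  induction hv using Submodule.span_induction with
  | mem v hv =>
    obtain ⟨i, rfl⟩ := hv
    exact h i
  | zero => simp
  | add v w _ _ hv hw => simpa only [map_add] using hv.add hw
  | smul c v _ hv => simpa only [map_smul] using hv.const_smul c

/-- The restriction to `𝓑` of a representation of the Cuntz relations with a vector fixed by an
aperiodic word. -/
theorem exists_isRBS_hasFock {H : Type u} [NormedAddCommGroup H] [InnerProductSpace ℂ H]
    [CompleteSpace H] {s : ℕ → (H →L[ℂ] H)}
    (hs : ∀ i j, star (s i) * s j = if i = j then 1 else 0) {J : List ℕ} (hJ : J ≠ []) {Ω : H}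
    (hΩ : ‖Ω‖ = 1) (hfix : wordOp s J Ω = Ω)
    (hap : ∀ l l', (∀ n, periodicSeq J hJ (n + l) = periodicSeq J hJ (n + l')) →
      l % J.length = l' % J.length)
    (hdense : Dense (orbitSpan s Ω : Set H)) :
    ∃ σ : BosonRep H, σ.IsRBS s (orbitSpan s Ω) ∧ σ.HasFock (tailClass (periodicSeq J hJ)) := by
  obtain ⟨e, hzero, hnorm, he, heΩ⟩ := exists_seq_basis hs hJ hfix hap
  have hspan : Submodule.span ℂ (Set.range e) = orbitSpan s Ω := by
    rw [span_range_eq_orbitSpan hJ he hzero, heΩ]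
  obtain ⟨σ, f, hf, hfe, hD⟩ := BosonRep.exists_isFockFamily update_mem_tailClass_iff e hzero
    (fun x hx => (hnorm x hx).trans hΩ) (fun x y => inner_eq_zero_of_ne hs he) (hspan ▸ hdense)
  have hD' := hD.trans hspan
  have hmem : ∀ (m : ℕ) (x : σ.D), star (s m) (x : H) ∈ σ.D := fun m x => by
    exact hD'.ge <| star_apply_mem_orbitSpan hs hJ hfix m (hD'.le x.2)
  have hstar : ∀ m x, star (s m) (e x) = if m = x 0 then e (fun n => x (n + 1)) else 0 := by
    intro m x
    rw [he x, star_apply_apply hs]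
  have hstar' : ∀ m x, (⟨star (s m) (f x : H), hmem m (f x)⟩ : σ.D)
      = if m = x 0 then f (fun n => x (n + 1)) else 0 := by
    intro m x
    apply Subtype.ext
    simp only [hfe, hstar]
    split_ifs
    · rw [hfe]
    · rfl
  let R : ℕ → Module.End ℂ σ.D := fun m =>
    ((star (s m) : H →L[ℂ] H) : H →ₗ[ℂ] H).restrict fun x hx => hmem m ⟨x, hx⟩
  let S : ℕ → σ.D →ₗ[ℂ] H := fun m => (s m : H →ₗ[ℂ] H) ∘ₗ σ.D.subtype
  refine ⟨σ, ⟨hD', hmem, ?_, fun n => ?_⟩, f, hf⟩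
  · refine hasSum_apply_of_span_eq_top (T := fun m : ℕ => (Real.sqrt ((m : ℝ) + 1) : ℂ) •
      S m ∘ₗ R (m + 1)) (T' := σ.D.subtype ∘ₗ σ.b 0) hf.span fun x => ?_
    change HasSum (fun m : ℕ => (Real.sqrt ((m : ℝ) + 1) : ℂ) • s m (star (s (m + 1)) (f x : H)))
      (σ.b 0 (f x) : H)
    rw [hf.b_apply, Submodule.coe_smul, hfe, hfe, he (Function.update x 0 (x 0 - 1))]
    simp only [Function.update_self, Function.update_of_ne (Nat.succ_ne_zero _), hstar]
    -- Only the term with `m + 1 = x 0` survives. If `x 0 = 0` there is none, in accordance with the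
    -- coefficient `√0` on the other side.
    rcases h0 : x 0 with _ | k
    · simp
    · rw [Nat.add_sub_cancel]
      have := hasSum_single (f := fun m : ℕ => (Real.sqrt ((m : ℝ) + 1) : ℂ) •
        s m (if m + 1 = k + 1 then e (fun n => x (n + 1)) else 0)) k
        (fun m hm => by rw [if_neg (by omega), map_zero, smul_zero])
      rw [if_pos rfl] at this
      exact_mod_cast this
  · refine hasSum_apply_of_span_eq_top (T := fun m => S m ∘ₗ σ.b n ∘ₗ R m)
      (T' := σ.D.subtype ∘ₗ σ.b (n + 1)) hf.span fun x => ?_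
    change HasSum (fun m : ℕ => s m (σ.b n ⟨star (s m) (f x : H), hmem m (f x)⟩ : H))
      (σ.b (n + 1) (f x) : H)
    simp only [hstar']
    rw [hf.b_apply, Submodule.coe_smul, hfe, he (Function.update x (n + 1) _)]
    -- Lowering entry `n + 1` and dropping the first letter is dropping the first letter and
    -- lowering entry `n`; the only contributing `m` is the first letter.
    have hu : (fun m => Function.update x (n + 1) (x (n + 1) - 1) (m + 1))
        = Function.update (fun m => x (m + 1)) n (x (n + 1) - 1) := by
      ext m
      simp [Function.update_apply]
    rw [hu, Function.update_of_ne (Nat.succ_ne_zero n).symm]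
    have := hasSum_single (f := fun m : ℕ =>
      s m (σ.b n (if m = x 0 then f (fun n => x (n + 1)) else 0) : H)) (x 0)
      (fun m hm => by rw [if_neg hm, map_zero, Submodule.coe_zero, map_zero])
    rw [if_pos rfl, hf.b_apply, Submodule.coe_smul, map_smul, hfe] at this
    exact this

open BosonRep

/-! ### Shift models: the classes of Cuntz representations are not empty -/

section Model

variable {ι : Type} {c : ℕ → ι}

theorem ext_inner_stdVec {α : Type} {X : Set α} {v w : SeqSpace.{u} X}
    (h : ∀ x ∈ X, ⟪stdVec X x, v⟫_ℂ = ⟪stdVec X x, w⟫_ℂ) : v = w := by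
  classical
  apply lp.ext
  ext ⟨⟨x, hx⟩⟩
  have h1 := h x hx
  rw [stdVec, dif_pos hx, lp.inner_single_left, lp.inner_single_left] at h1
  simpa using h1

theorem ext_stdVec {α : Type} {X : Set α} {E : Type*} [NormedAddCommGroup E] [NormedSpace ℂ E]
    {S T : SeqSpace.{u} X →L[ℂ] E}
    (h : ∀ x ∈ X, S (stdVec X x) = T (stdVec X x)) : S = T := by
  refine ContinuousLinearMap.ext_on (dense_span_stdVec X) ?_
  rintro _ ⟨x, rfl⟩
  by_cases hx : x ∈ X
  · exact h x hx
  · rw [stdVec_of_notMem hx, map_zero, map_zero]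

theorem orthonormal_stdVec_seqCons (c : ℕ → ι) (i : ι) :
    Orthonormal ℂ fun y : ULift.{u} (tailClass c) =>
      (stdVec (tailClass c) (seqCons i y.down) : SeqSpace.{u} (tailClass c)) := by
  refine ⟨fun y => norm_stdVec ((seqCons_mem_tailClass_iff i).2 y.down.2), fun y z hyz => ?_⟩
  refine inner_stdVec fun h => hyz ?_
  apply ULift.ext
  apply Subtype.ext
  exact funext fun n => congrFun h (n + 1)

/-- The generators of the permutative representation of a Cuntz algebra on the space of sequences
with a tail in common with `c`. -/
noncomputable def shiftOp (c : ℕ → ι) (i : ι) :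
    SeqSpace.{u} (tailClass c) →L[ℂ] SeqSpace.{u} (tailClass c) :=
  (orthonormal_stdVec_seqCons c i).orthogonalFamily.linearIsometry.toContinuousLinearMap

theorem shiftOp_stdVec (i : ι) (x : ℕ → ι) :
    shiftOp c i (stdVec (tailClass c) x : SeqSpace.{u} (tailClass c))
      = stdVec (tailClass c) (seqCons i x) := by
  classical
  by_cases hx : x ∈ tailClass c
  · have h : (stdVec (tailClass c) x : SeqSpace.{u} (tailClass c)) = lp.single 2 ⟨⟨x, hx⟩⟩ (1 : ℂ) :=
      dif_pos hx
    rw [h]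
    refine ((orthonormal_stdVec_seqCons c i).orthogonalFamily.linearIsometry_apply_single _).trans ?_
    simp
  · rw [stdVec_of_notMem hx, stdVec_of_notMem (by rwa [seqCons_mem_tailClass_iff]), map_zero]

theorem stdVec_eq_shiftOp (x : ℕ → ι) :
    (stdVec (tailClass c) x : SeqSpace.{u} (tailClass c))
      = shiftOp c (x 0) (stdVec (tailClass c) fun n => x (n + 1)) := by
  rw [shiftOp_stdVec]
  congr 1
  funext n
  cases n <;> rfl

/-- Partial words of `J` send the basis vector of the periodic sequence to those of its shifts,
which aperiodicity keeps distinct within one period. -/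
theorem isGPVector_stdVec {J : List ι} (hJ : J ≠ [])
    (hap : ∀ l l', (∀ n, periodicSeq J hJ (n + l) = periodicSeq J hJ (n + l')) →
      l % J.length = l' % J.length) :
    IsGPVector (shiftOp.{u} (periodicSeq J hJ)) J (stdVec _ (periodicSeq J hJ)) := by
  set c := periodicSeq J hJ with hc
  let e : (ℕ → ι) → SeqSpace.{u} (tailClass c) := stdVec (tailClass c)
  have he : ∀ x, e x = shiftOp c (x 0) (e fun n => x (n + 1)) := stdVec_eq_shiftOp
  have hmem : ∀ l, (fun n => c (n + l)) ∈ tailClass c := fun l => ⟨0, l, fun _ => rfl⟩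
  have hdrop : ∀ l ≤ J.length, wordOp (shiftOp c) (J.drop l) (e c) = e fun n => c (n + l) := by
    intro l hl
    have hper : (fun n => c (n + (J.length - l) + l)) = c := by
      funext n
      rw [add_assoc, Nat.sub_add_cancel hl, hc, periodicSeq_add_of_dvd dvd_rfl]
    rw [drop_eq_map_periodicSeq (hJ := hJ) hl,
      apply_eq_wordOp_apply he (fun n => c (n + l)) (J.length - l), hper]
  refine ⟨norm_stdVec (hmem 0), ?_, hdrop 0 (Nat.zero_le _), ?_, ?_⟩
  · have h := dense_span_stdVec.{u} (tailClass c)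
    rw [span_range_eq_orbitSpan hJ he fun x hx => stdVec_of_notMem hx] at h
    refine h.mono ?_
    let M : Submodule ℂ (SeqSpace.{u} (tailClass c)) :=
      (Subalgebra.toSubmodule (StarAlgebra.adjoin ℂ (Set.range (shiftOp.{u} c))).toSubalgebra).map
        (ContinuousLinearMap.apply ℂ (SeqSpace.{u} (tailClass c)) (e c)).toLinearMap
    have hle : orbitSpan (shiftOp c) (e c) ≤ M := by
      refine Submodule.span_le.2 ?_
      rintro _ ⟨I, rfl⟩
      refine ⟨wordOp (shiftOp c) I, ?_, rfl⟩
      refine list_prod_mem (S := StarAlgebra.adjoin ℂ (Set.range (shiftOp.{u} c))) ?_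
      intro T hT
      obtain ⟨i, -, rfl⟩ := List.mem_map.1 hT
      exact StarAlgebra.subset_adjoin _ _ ⟨i, rfl⟩
    intro v hv
    obtain ⟨T, hT, hTv⟩ := hle hv
    exact ⟨T, hT, hTv⟩
  · intro l
    exact (congrArg norm (hdrop l l.2.le)).trans (norm_stdVec (hmem l))
  · intro l l' hll
    refine (congrArg₂ (inner ℂ) (hdrop l l.2.le) (hdrop l' l'.2.le)).trans ?_
    refine inner_stdVec fun h => hll ?_
    have := hap l l' fun n => congrFun h n
    rw [Nat.mod_eq_of_lt l.2, Nat.mod_eq_of_lt l'.2] at this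
    exact Fin.ext this

variable [DecidableEq ι]

theorem star_shiftOp_mul (c : ℕ → ι) (i j : ι) :
    star (shiftOp.{u} c i) * shiftOp c j = if i = j then 1 else 0 := by
  refine ext_stdVec fun x hx => ext_inner_stdVec fun y hy => ?_
  change ⟪_, star (shiftOp c i) (shiftOp c j (stdVec _ x))⟫_ℂ = _
  rw [ContinuousLinearMap.star_eq_adjoint, ContinuousLinearMap.adjoint_inner_right]
  split_ifs with h
  · subst h
    exact LinearIsometry.inner_map_map _ _ _
  · rw [shiftOp_stdVec, shiftOp_stdVec, inner_stdVec fun hc => h (congrFun hc 0)]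
    exact (inner_zero_right _).symm

theorem isCuntzTwo_shiftOp (c : ℕ → Fin 2) : IsCuntzTwo (shiftOp.{u} c) := by
  refine ⟨star_shiftOp_mul c, ext_stdVec fun x _ => ?_⟩
  rw [stdVec_eq_shiftOp x]
  generalize x 0 = i
  change shiftOp c 0 (star (shiftOp c 0) (shiftOp c i _))
    + shiftOp c 1 (star (shiftOp c 1) (shiftOp c i _)) = shiftOp c i _
  rw [star_apply_apply (star_shiftOp_mul c), star_apply_apply (star_shiftOp_mul c)]
  fin_cases i <;> simp

/-- The ranges of the generators are mutually orthogonal, so each partial sum is a projection. -/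
theorem isCuntzInfty_shiftOp (c : ℕ → ℕ) : IsCuntzInfty (shiftOp.{u} c) := by
  refine ⟨star_shiftOp_mul c, fun k => IsStarProjection.le_one ⟨?_, ?_⟩⟩
  · rw [IsIdempotentElem, Finset.sum_mul_sum]
    refine Finset.sum_congr rfl fun i hi => ?_
    rw [Finset.sum_eq_single_of_mem i hi]
    · rw [mul_assoc, ← mul_assoc (star _), star_shiftOp_mul, if_pos rfl, one_mul]
    · intro j _ hj
      rw [mul_assoc, ← mul_assoc (star _), star_shiftOp_mul, if_neg hj.symm, zero_mul, mul_zero]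
  · simp [IsSelfAdjoint, star_sum]

end Model

/-! ### The embedding of $\mathcal O_\infty$ into $\mathcal O_2$ -/

section Embedding

variable {H : Type u} [NormedAddCommGroup H] [InnerProductSpace ℂ H]

theorem cuntzEmbedding_apply (t : Fin 2 → (H →L[ℂ] H)) (m : ℕ) (v : H) :
    cuntzEmbedding t m v = (t 1 ^ m) (t 0 v) := rfl

/-- A word ending in `t 0` parses into blocks `t 1 ^ m * t 0`: a prepended `0` opens a new block, a
prepended `1` lengthens the first one. -/
theorem exists_wordOp_cuntzEmbedding (t : Fin 2 → (H →L[ℂ] H)) (v : H) (I : List (Fin 2)) :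
    ∃ m I', wordOp t I (t 0 v) = wordOp (cuntzEmbedding t) (m :: I') v := by
  induction I with
  | nil => exact ⟨0, [], rfl⟩
  | cons i I ih =>
    obtain ⟨m, I', h⟩ := ih
    rw [wordOp_cons_apply, h]
    match i with
    | 0 => exact ⟨0, m :: I', by rw [wordOp_cons_apply _ 0]; rfl⟩
    | 1 =>
      refine ⟨m + 1, I', ?_⟩
      rw [wordOp_cons_apply, wordOp_cons_apply, cuntzEmbedding_apply, cuntzEmbedding_apply, pow_succ']
      rfl

theorem exists_wordOp_eq_cuntzEmbedding (t : Fin 2 → (H →L[ℂ] H)) (v : H) (I : List ℕ) :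
    ∃ I', wordOp (cuntzEmbedding t) I v = wordOp t I' v := by
  induction I with
  | nil => exact ⟨[], rfl⟩
  | cons m I ih =>
    obtain ⟨I', h⟩ := ih
    refine ⟨List.replicate m 1 ++ 0 :: I', ?_⟩
    rw [wordOp_cons_apply, h, wordOp_append_apply, wordOp_replicate_apply, wordOp_cons_apply,
      cuntzEmbedding_apply]

/-- Since `Ω` equals `t 0 Ω'`, every word applied to it ends in `t 0` when read on `Ω'` and so
parses into blocks; conversely `W` leads from `Ω` back to `Ω'`. -/
theorem orbitSpan_cuntzEmbedding {t : Fin 2 → (H →L[ℂ] H)} {Ω Ω' : H} {W : List (Fin 2)}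
    (h : t 0 Ω' = Ω) (h' : wordOp t W Ω = Ω') :
    orbitSpan (cuntzEmbedding t) Ω' = orbitSpan t Ω := by
  apply le_antisymm
  · refine Submodule.span_le.2 ?_
    rintro _ ⟨I, rfl⟩
    obtain ⟨I', hI'⟩ := exists_wordOp_eq_cuntzEmbedding t Ω' I
    refine Submodule.subset_span ⟨I' ++ W, ?_⟩
    simp only
    rw [hI', wordOp_append_apply, h']
  · refine Submodule.span_le.2 ?_
    rintro _ ⟨I, rfl⟩
    obtain ⟨m, I', hI'⟩ := exists_wordOp_cuntzEmbedding t Ω' I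
    refine Submodule.subset_span ⟨m :: I', ?_⟩
    simp only
    rw [← hI', h]

theorem star_cuntzEmbedding_mul [CompleteSpace H] {t : Fin 2 → (H →L[ℂ] H)}
    (ht : ∀ i j, star (t i) * t j = if i = j then 1 else 0) (i j : ℕ) :
    star (cuntzEmbedding t i) * cuntzEmbedding t j = if i = j then 1 else 0 := by
  have h00 : star (t 0) * t 0 = 1 := ht 0 0
  have h11 : star (t 1) * t 1 = 1 := ht 1 1
  have h01 : star (t 0) * t 1 = 0 := ht 0 1
  have h10 : star (t 1) * t 0 = 0 := ht 1 0
  simp only [cuntzEmbedding, star_mul, star_pow]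
  induction i generalizing j with
  | zero =>
    rcases j with _ | j
    · simpa using h00
    · rw [pow_zero, mul_one, pow_succ', mul_assoc (t 1), ← mul_assoc, h01, zero_mul,
        if_neg (by omega)]
  | succ i ih =>
    rcases j with _ | j
    · rw [pow_zero, one_mul, pow_succ, mul_assoc, mul_assoc, h10, mul_zero, mul_zero,
        if_neg (by omega)]
    · have := ih j
      rw [pow_succ, pow_succ' (t 1), mul_assoc, mul_assoc, mul_assoc (t 1), ← mul_assoc (star (t 1)),
        h11, one_mul, ← mul_assoc, this]
      simp

end Embedding

/-! ### Combinatorics of the periodic words -/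

theorem periodicSeq_replicate_append {ι : Type} [DecidableEq ι] (k : ℕ) (i j : ι) (n : ℕ) :
    periodicSeq (List.replicate k i ++ [j]) (by simp) n = if n % (k + 1) = k then j else i := by
  have h : n % (k + 1) < k + 1 := Nat.mod_lt n (Nat.succ_pos k)
  simp only [periodicSeq, List.getElem_append, List.length_replicate, List.length_append,
    List.length_singleton, List.getElem_replicate, List.getElem_singleton]
  split_ifs <;> first | rfl | omega

theorem periodicSeq_cons_replicate {ι : Type} (k : ℕ) (i j : ι) (n : ℕ) :
    periodicSeq (j :: List.replicate k i) (by simp) n = if n % (k + 1) = 0 then j else i := by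
  simp only [periodicSeq, List.getElem_cons, List.length_replicate, List.length_cons,
    List.getElem_replicate]
  split_ifs <;> rfl

theorem aperiodic_replicate_append {ι : Type} (k : ℕ) {i j : ι} (h : k = 0 ∨ i ≠ j) (l l' : ℕ)
    (hl : ∀ n, periodicSeq (List.replicate k i ++ [j]) (by simp) (n + l)
      = periodicSeq (List.replicate k i ++ [j]) (by simp) (n + l')) :
    l % (List.replicate k i ++ [j]).length = l' % (List.replicate k i ++ [j]).length := by
  classical
  rcases h with rfl | h
  · simp [Nat.mod_one]
  · refine mod_eq_of_letter (α := j) (r := k) (by simp) (fun n => ?_) hl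
    rw [periodicSeq_replicate_append]
    simp [h]

theorem aperiodic_cons_replicate {ι : Type} (k : ℕ) {i j : ι} (h : i ≠ j) (l l' : ℕ)
    (hl : ∀ n, periodicSeq (j :: List.replicate k i) (by simp) (n + l)
      = periodicSeq (j :: List.replicate k i) (by simp) (n + l')) :
    l % (j :: List.replicate k i).length = l' % (j :: List.replicate k i).length := by
  refine mod_eq_of_letter (α := j) (r := 0) (by simp) (fun n => ?_) hl
  rw [periodicSeq_cons_replicate]
  simp [h]

theorem tailClass_replicate_append (k c : ℕ) :
    tailClass (periodicSeq (List.replicate k 0 ++ [c]) (by simp))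
      = ⋃ i : Fin (k + 1), eventuallyEq (periodicOcc (k + 1) i c) := by
  ext x
  rw [Set.mem_iUnion]
  constructor
  · rintro ⟨a, l, h⟩
    -- The letter `c` sits in `x` at the positions congruent to `k + a - l`; modulo `k + 1` the term
    -- `k * l` stands for `-l`.
    refine ⟨⟨(k + a + k * l) % (k + 1), Nat.mod_lt _ (Nat.succ_pos k)⟩, a, fun n hn => ?_⟩
    obtain ⟨m, rfl⟩ := Nat.exists_eq_add_of_le' hn
    rw [h, periodicSeq_replicate_append, periodicOcc]
    refine if_congr ?_ rfl rfl
    change (m + l) % (k + 1) = k ↔ m + a ≡ k + a + k * l [MOD k + 1]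
    have h1 : (m + l) % (k + 1) = k ↔ m + l ≡ k [MOD k + 1] := by
      rw [Nat.ModEq, Nat.mod_eq_of_lt (Nat.lt_succ_self k)]
    have h2 : m + l + (a + k * l) ≡ m + a [MOD k + 1] := by
      rw [show m + l + (a + k * l) = m + a + (k + 1) * l by ring]
      simp [Nat.ModEq]
    rw [h1]
    constructor
    · intro h3
      exact h2.symm.trans (by simpa [add_assoc] using h3.add_right (a + k * l))
    · intro h3
      exact Nat.ModEq.add_right_cancel' (a + k * l) (h2.trans (by simpa [add_assoc] using h3))
  · rintro ⟨i, a, h⟩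
    -- Shifting by `k - i` moves the residue `i` to `k`, the place of `c` in the period.
    refine ⟨a, a + (k - i), fun n => ?_⟩
    rw [h _ (Nat.le_add_left a n), periodicSeq_replicate_append, periodicOcc]
    refine if_congr ?_ rfl rfl
    have hi := i.2
    have h1 : (n + a) % (k + 1) = i ↔ n + a ≡ i [MOD k + 1] := by
      rw [Nat.ModEq, Nat.mod_eq_of_lt hi]
    have h2 : (n + (a + (k - i))) % (k + 1) = k ↔ n + a + (k - i) ≡ i + (k - i) [MOD k + 1] := by
      rw [Nat.ModEq, Nat.add_sub_cancel' (by omega), Nat.mod_eq_of_lt (Nat.lt_succ_self k), add_assoc]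
    rw [h1, h2]
    exact ⟨fun h => h.add_right _, fun h => Nat.ModEq.add_right_cancel' _ h⟩

/-! ### The branching laws -/

theorem rbsRestrictionClassEq_of_word {H : Type u} [NormedAddCommGroup H] [InnerProductSpace ℂ H]
    [CompleteSpace H] {s : ℕ → (H →L[ℂ] H)}
    (hs : ∀ i j, star (s i) * s j = if i = j then 1 else 0) {k c : ℕ} (hkc : k = 0 ∨ 0 ≠ c) {Ω : H}
    (hΩ : ‖Ω‖ = 1) (hfix : wordOp s (List.replicate k 0 ++ [c]) Ω = Ω)
    (hdense : Dense (orbitSpan s Ω : Set H)) {C : BosonClass.{u}}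
    (hC : ∀ (K : Type u) [NormedAddCommGroup K] [InnerProductSpace ℂ K] [CompleteSpace K]
      (τ : BosonRep K),
      C K τ ↔ τ.HasFock (⋃ i : Fin (k + 1), eventuallyEq (periodicOcc (k + 1) i c))) :
    RBSRestrictionClassEq s (orbitSpan s Ω) C := by
  obtain ⟨σ, hσ, hF⟩ := exists_isRBS_hasFock hs (by simp) hΩ hfix
    (aperiodic_replicate_append k hkc) hdense
  rw [tailClass_replicate_append] at hF
  refine ⟨σ, hσ, fun K _ _ _ τ => ?_⟩
  rw [hC]
  exact ⟨fun h => h.unitaryEquiv hF, fun h => hF.of_unitaryEquiv h⟩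

theorem pTwoRestrictsTo_cons_replicate (k : ℕ) :
    PTwoRestrictsTo.{u} ((0 : Fin 2) :: List.replicate k 1) (BF 1 0 ((k + 1 : ℕ) : ℝ)) := by
  refine ⟨⟨_, inferInstance, inferInstance, inferInstance, _, _, isCuntzTwo_shiftOp _,
    isGPVector_stdVec (by simp) (aperiodic_cons_replicate k (by simp))⟩, ?_⟩
  intro H _ _ _ t Ω ht hΩ
  have hfix : t 0 (wordOp t (List.replicate k 1) Ω) = Ω := by
    rw [← wordOp_cons_apply]
    exact hΩ.fixed
  have hspan := orbitSpan_cuntzEmbedding hfix rfl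
  rw [← hspan]
  -- The vector $t_2^k\Omega$ is fixed by the single generator $t_2^k t_1$, a one-letter word. Such
  -- a word needs no condition on its letter, which may be `0`.
  refine rbsRestrictionClassEq_of_word (k := 0) (c := k) (star_cuntzEmbedding_mul ht.star_mul)
    (Or.inl rfl) ?_ ?_ ?_ ?_
  · rw [norm_wordOp_apply ht.star_mul, hΩ.norm_eq]
  · change cuntzEmbedding t k (wordOp t (List.replicate k 1) Ω) = _
    rw [cuntzEmbedding_apply, hfix, wordOp_replicate_apply]
  · rw [hspan]
    exact hΩ.dense_orbitSpan (by simp) ht.star_mul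
  · intro K _ _ _ τ
    rw [show (⋃ i : Fin (0 + 1), eventuallyEq (periodicOcc (0 + 1) i k))
      = eventuallyEq (periodicOcc 1 (0 : Fin 1) k) from
      iSup_unique fun i : Fin 1 => eventuallyEq (periodicOcc 1 i k)]
    exact isBF_iff_hasFock 0 k τ

theorem pInftyRestrictsTo_replicate_append (k : ℕ) :
    PInftyRestrictsTo.{u} (List.replicate k 0 ++ [1]) (SumBF (k + 1) 2) := by
  refine ⟨⟨_, inferInstance, inferInstance, inferInstance, _, _, isCuntzInfty_shiftOp _,
    isGPVector_stdVec (by simp) (aperiodic_replicate_append k (by simp))⟩, ?_⟩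
  intro H _ _ _ s Ω hs hΩ
  refine rbsRestrictionClassEq_of_word hs.star_mul (Or.inr zero_ne_one) hΩ.norm_eq hΩ.fixed
    (hΩ.dense_orbitSpan (by simp) hs.star_mul) fun K _ _ _ τ => ?_
  rw [← isSumBF_iff_hasFock one_ne_zero]
  norm_num [SumBF]

theorem pTwoRestrictsTo_replicate_append (k : ℕ) :
    PTwoRestrictsTo.{u} (List.replicate (k + 1) (0 : Fin 2) ++ [1]) (SumBF (k + 1) 2) := by
  refine ⟨⟨_, inferInstance, inferInstance, inferInstance, _, _, isCuntzTwo_shiftOp _,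
    isGPVector_stdVec (by simp) (aperiodic_replicate_append _ (by simp))⟩, ?_⟩
  intro H _ _ _ t Ω ht hΩ
  have hfix : t 0 (wordOp t (List.replicate k 0 ++ [1]) Ω) = Ω := by
    rw [← wordOp_cons_apply, ← List.cons_append, ← List.replicate_succ]
    exact hΩ.fixed
  have hspan := orbitSpan_cuntzEmbedding hfix rfl
  rw [← hspan]
  -- With $\Omega'=t_1^k t_2\Omega$, the word $s_1^k s_2=t_1^k t_2 t_1$ sends `Ω'` to $t_1^k
  -- t_2\Omega$, that is, to itself. This is the word of the $\mathcal O_\infty$ law.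
  refine rbsRestrictionClassEq_of_word (k := k) (star_cuntzEmbedding_mul ht.star_mul)
    (Or.inr zero_ne_one) ?_ ?_ ?_ fun K _ _ _ τ => ?_
  · rw [norm_wordOp_apply ht.star_mul, hΩ.norm_eq]
  · have h1 : cuntzEmbedding t 1 (wordOp t (List.replicate k 0 ++ [1]) Ω) = t 1 Ω := by
      rw [cuntzEmbedding_apply, hfix, pow_one]
    rw [wordOp_append_apply, wordOp_cons_apply, wordOp_nil_apply, h1, wordOp_append_apply,
      wordOp_replicate_apply, wordOp_replicate_apply, wordOp_cons_apply, wordOp_nil_apply]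
    rfl
  · rw [hspan]
    exact hΩ.dense_orbitSpan (by simp) ht.star_mul
  · rw [← isSumBF_iff_hasFock one_ne_zero]
    norm_num [SumBF]

theorem mainTheorem5 (p : ℕ) (hp : 1 ≤ p) :
    PTwoRestrictsTo.{u} ((0 : Fin 2) :: List.replicate (p - 1) 1) (BF 1 0 (p : ℝ)) ∧
    PInftyRestrictsTo.{u} (List.replicate (p - 1) 0 ++ [1]) (SumBF p 2) ∧
    PTwoRestrictsTo.{u} (List.replicate p (0 : Fin 2) ++ [1]) (SumBF p 2) := by
  obtain ⟨k, rfl⟩ := Nat.exists_eq_add_of_le' hp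
  rw [Nat.add_sub_cancel]
  exact ⟨pTwoRestrictsTo_cons_replicate k, pInftyRestrictsTo_replicate_append k,
    pTwoRestrictsTo_replicate_append k⟩
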